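/- **Setting.** Let $d,t\ge 1$ be integers and let $O\in M_d(\mathbb C)$ be Hermitian. Let $\mu_H$ be the Haar probability measure on $\mathrm U(d)$, and let $C_O=\{V\in \mathrm U(d): VO=OV\}$. Consider $2t+2$ systems, each a copy of $\mathbb C^d$, in the causal order $P,I_1,O_1,\dots,I_t,O_t,F$, numbered $1,\dots,2t+2$. Write $|U\rangle\!\rangle=\sum_k e_k\otimes Ue_k$. For an operator $C$ on the $2t+2$ systems put $$C*|U\rangle\!\rangle\!\langle\!\langle U|^{\otimes t}=\operatorname{Tr}_{\boldsymbol{IO}}\big[C^{T_{\boldsymbol{IO}}}(1_P\otimes |U\rangle\!\rangle\!\langle\!\langle U|^{\otimes t}_{\boldsymbol{IO}}\otimes 1_F)\big],$$ an operator on $P\otimes F$, and let $\mathsf F$ be the switch operator of the two tensor factors. **Original SDP (sequential combs).** Minimize $$f(C)=\int_{\mathrm U(d)}\Big\|\operatorname{Tr}_F\big[\mathsf F\,(C*|U\rangle\!\rangle\!\langle\!\langle U|^{\otimes t})^{T}\,\mathsf F\,(O_F^T\otimes 1_P)-|U\rangle\!\rangle\!\langle\!\langle U|_{FP}(O_F^T\otimes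 1_P)\big]\Big\|_F\,d\mu_H(U)$$ over all $C\succeq 0$ with $\operatorname{Tr}C=d^{t+1}$ and $\operatorname{Tr}_{\mathbf{K-1}}C=\operatorname{Tr}_{\mathbf K}C\otimes \frac{1}{d}I_d$ for every $K\in\{2,4,\dots,2t+2\}$, where $\operatorname{Tr}_{\mathbf K}$ is the partial trace over the last $K$ systems. **Schur bases.** Let $\rho(U,V,W)=U^{\otimes t+1}\otimes V^{\otimes t}\otimes W$ on $(\mathbb C^d)^{\otimes 2t+2}$, for $(U,V,W)\in\mathrm U(d)\times C_O\times C_O$. A Schur basis is an orthonormal basis $v_{r,a,\alpha}$ ($r\in I$, $1\le a\le \dim V_r$, $1\le\alpha\le m_r$) in which $\rho$ becomes $\bigoplus_{r\in I}\rho^r\otimes 1_{m_r}$, where the $\rho^r$ are pairwise inequivalent irreducible representations on $V_r=\mathbb C^{\dim V_r}$ and $m_r\ge1$. Let $p^{r,a,\alpha}_{i}$, $i\in[d]^{2t+2}$, be the coordinates of $v_{r,a,\alpha}$ in the computational basis. Let $\pi\in S_{2t+2}$ be any permutation of positions that takes the causal order to the order $P,O_1,\dots,O_t,I_1,\dots,I_t,F$,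 up to the order among the $O_k$ and the order among the $I_k$ (thus $P,F$ stay first and last). Put $P_\pi(i)_l=i_{\pi^{-1}(l)}$. For $K\in\{2,4,\dots,2t+2\}$ let $\mathbf{R_K}$ be the first $2t+2-K$ systems. For $i_{\mathbf{R_K}}\in[d]^{2t+2-K}$ and $x\in[d]$ let $\operatorname{Supp}_{r,K}^{\pi}(i_{\mathbf{R_K}},x)$ be the set of all $(a,z)\in[\dim V_r]\times[d]^{K-1}$ such that $p^{r,a,\alpha}_{P_\pi(i_{\mathbf{R_K}},x,z)}\ne0$ for some $\alpha$. Define the $m_r\times m_r$ matrices $$[M_K^{r,\pi}(i_{\mathbf{R_K}},x,j_{\mathbf{R_K}},y)]_{\beta,\alpha}=\sum_{(a,z)\in \operatorname{Supp}_{r,K}^{\pi}(i_{\mathbf{R_K}},x)\cap \operatorname{Supp}_{r,K}^{\pi}(j_{\mathbf{R_K}},y)} p^{r,a,\alpha}_{P_\pi(i_{\mathbf{R_K}},x,z)}\,\overline{p^{r,a,\beta}_{P_\pi(j_{\mathbf{R_K}},y,z)}}$$ (zero if the intersection is empty), and let $S_K^\pi$ be the set of pairs $((i_{\mathbf{R_K}},x),(j_{\mathbf{R_K}},y))$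 for which this intersection is non-empty for some $r\in I$. For $i_1,j_1\in[d]$ define $$[M_{U,O}^{r,\pi}(j_1,i_1)]_{\beta,\alpha}=\sum_{a}\ \sum_{\substack{i_2,\dots,i_{2t+2}\in[d]\\ j_2,\dots,j_{2t+2}\in[d]}} p^{r,a,\alpha}_{P_\pi(i)}\,\overline{p^{r,a,\beta}_{P_\pi(j)}}\ \prod_{l=2}^{t+1}U_{i_{2l-1},i_{2l-2}}\overline{U_{j_{2l-1},j_{2l-2}}}\ \operatorname{Tr}\big(|e_{j_{2t+2}}\rangle\langle e_{i_{2t+2}}|O^T\big),$$ where only those $i$, $j$ contribute for which $p^{r,a,\alpha}_{P_\pi(i)}\neq0$ and $p^{r,a,\beta}_{P_\pi(j)}\ne0$. **Reduced SDP.** Over families $X=(C^{(r)})_{r\in I}$ of $m_r\times m_r$ matrices with $C^{(r)}\succeq0$, minimize $$g(X)=\int_{\mathrm U(d)}\Big\|\sum_{r}\sum_{i_1,j_1}\operatorname{Tr}\big[C^{(r)}M_{U,O}^{r,\pi}(j_1,i_1)\big]\,|e_{j_1}\rangle\langle e_{i_1}|-UOU^\dagger\Big\|_F\,d\mu_H(U)$$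 subject to $\sum_r\dim(V_r)\operatorname{Tr}C^{(r)}=d^{t+1}$ and, for all $K\in\{2,4,\dots,2t+2\}$ and all $((i_{\mathbf{R_K}},x),(j_{\mathbf{R_K}},y))\in S_K^\pi$, $$\sum_r\operatorname{Tr}\big[C^{(r)}M_K^{r,\pi}(i_{\mathbf{R_K}},x,j_{\mathbf{R_K}},y)\big]=\frac{\delta_{x,y}}d\sum_{z\in[d]}\sum_r\operatorname{Tr}\big[C^{(r)}M_K^{r,\pi}(i_{\mathbf{R_K}},z,j_{\mathbf{R_K}},z)\big].$$ **Theorem.** The integrand of $f$ is $\mu_H$-integrable for every $C$, and a Schur basis exists. For every Schur basis and every such $\pi$ the two SDPs are equivalent, in the following sense. 1. The map sending $X=(C^{(r)})_r$ to the operator $C$ with entries $C_{i,j}=\sum_r\sum_{\alpha,\beta}\sum_a C^{(r)}_{\alpha\beta}\,p^{r,a,\alpha}_{P_\pi(i)}\,\overline{p^{r,a,\beta}_{P_\pi(j)}}$ is a bijection from all families of blocks onto the operators $C$ with $[C,U\otimes(V\otimes U)^{\otimes t}\otimes W]=0$ for all $U\in\mathrm U(d)$ and $V,W\in C_O$. 2.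 $X$ satisfies the constraints of the reduced SDP if and only if its image $C$ satisfies those of the original SDP, and $g(X)=f(C)$ for every $X$. 3. Both minima are attained and they are equal. -/

import Mathlib

open MeasureTheory
open scoped ComplexOrder Kronecker

noncomputable section

namespace ShadowInversion

/-! ## The unitary group, its Haar probability measure, and the centralizer of an observable -/

/-- The unitary group `U(d)`. -/
abbrev UGroup (d : ℕ) : Type := Matrix.unitaryGroup (Fin d) ℂ

instance instMeasurableSpaceUGroup (d : ℕ) : MeasurableSpace (UGroup d) := borel _

instance instBorelSpaceUGroup (d : ℕ) : BorelSpace (UGroup d) := ⟨rfl⟩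

instance instCompactSpaceUGroup (d : ℕ) : CompactSpace (UGroup d) := by
  have hc : IsCompact (Set.pi Set.univ
      (fun _ : Fin d => Set.pi Set.univ (fun _ : Fin d => Metric.closedBall (0 : ℂ) 1))) :=
    isCompact_univ_pi fun _ => isCompact_univ_pi fun _ => isCompact_closedBall _ _
  have hcl : IsClosed (Matrix.unitaryGroup (Fin d) ℂ : Set (Matrix (Fin d) (Fin d) ℂ)) :=
    isClosed_unitary
  refine isCompact_iff_compactSpace.mp (hc.of_isClosed_subset hcl ?_)
  intro U hU i _ j _
  simpa using entry_norm_bound_of_unitary hU i j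

/-- The Haar probability measure on `U(d)`: the Haar measure giving the whole group mass `1`. -/
def haarU (d : ℕ) : Measure (UGroup d) := Measure.haarMeasure ⊤

/-- The centralizer `C_O = {U ∈ U(d) | U O = O U}`. -/
def centralizerU {d : ℕ} (O : Matrix (Fin d) (Fin d) ℂ) : Subgroup (UGroup d) where
  carrier := {U | (U : Matrix (Fin d) (Fin d) ℂ) * O = O * U}
  one_mem' := by simp
  mul_mem' := by
    intro U V hU hV
    simp only [Set.mem_ofPred_eq, Submonoid.coe_mul] at hU hV ⊢
    rw [mul_assoc, hV, ← mul_assoc, hU, mul_assoc]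
  inv_mem' := by
    intro U hU
    simp only [Set.mem_ofPred_eq] at hU ⊢
    have h1 : ((U⁻¹ : UGroup d) : Matrix (Fin d) (Fin d) ℂ) * U = 1 := by
      rw [← Submonoid.coe_mul]; simp
    have h2 : (U : Matrix (Fin d) (Fin d) ℂ) * ((U⁻¹ : UGroup d) : Matrix (Fin d) (Fin d) ℂ) = 1 := by
      rw [← Submonoid.coe_mul]; simp
    calc ((U⁻¹ : UGroup d) : Matrix (Fin d) (Fin d) ℂ) * O
        = ((U⁻¹ : UGroup d) : Matrix (Fin d) (Fin d) ℂ) * (O * U) *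
            ((U⁻¹ : UGroup d) : Matrix (Fin d) (Fin d) ℂ) := by
          rw [mul_assoc, mul_assoc, h2, mul_one]
      _ = O * ((U⁻¹ : UGroup d) : Matrix (Fin d) (Fin d) ℂ) := by
          rw [← hU, ← mul_assoc, h1, one_mul]

/-- The Frobenius norm of a square matrix. -/
def frobNorm {d : ℕ} (A : Matrix (Fin d) (Fin d) ℂ) : ℝ :=
  (Matrix.frobeniusNormedAddCommGroup (m := Fin d) (n := Fin d) (α := ℂ)).toNorm.norm A

/-! ## Operators on tensor powers of `ℂ^d`

The computational basis of `(ℂ^d)^{⊗ n}` is indexed by the tuples `Fin n → Fin d`. -/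

/-- Multi-indices of the computational basis of `(ℂ^d)^{⊗ n}`. -/
abbrev Idx (d n : ℕ) : Type := Fin n → Fin d

/-- Operators on `(ℂ^d)^{⊗ n}`. -/
abbrev TOp (d n : ℕ) : Type := Matrix (Idx d n) (Idx d n) ℂ

/-- The operator `A_1 ⊗ ⋯ ⊗ A_n`. -/
def tensorOp {d n : ℕ} (A : Fin n → Matrix (Fin d) (Fin d) ℂ) : TOp d n :=
  Matrix.of fun i j => ∏ l, A l (i l) (j l)

/-- The multi-index on `n` systems made of its first `m` entries and its last `n - m` entries. -/
def glue {d n m : ℕ} (i : Idx d m) (z : Idx d (n - m)) : Idx d n := fun l =>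
  if h : (l : ℕ) < m then i ⟨l, h⟩ else z ⟨l - m, by omega⟩

/-- Partial trace of an operator on `n` systems over all systems but the first `m`. -/
def tailTrace {d n : ℕ} (m : ℕ) (A : TOp d n) : TOp d m :=
  Matrix.of fun i j => ∑ z : Idx d (n - m), A (glue i z) (glue j z)

/-- The operator `A ⊗ B`, where `B` acts on one further (last) system. -/
def tensorLast {d m : ℕ} (A : TOp d m) (B : Matrix (Fin d) (Fin d) ℂ) : TOp d (m + 1) :=
  Matrix.of fun i j => A (Fin.init i) (Fin.init j) * B (i (Fin.last m)) (j (Fin.last m))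

/-! ## The positions of the systems in the causal order `P, I_1, O_1, …, I_t, O_t, F` -/

/-- Position of `P`. -/
def posP (t : ℕ) : Fin (2 * t + 2) := ⟨0, by omega⟩

/-- Position of the input system `I_{k+1}` of the slot number `k + 1`. -/
def posI {t : ℕ} (k : Fin t) : Fin (2 * t + 2) := ⟨2 * k + 1, by omega⟩

/-- Position of the output system `O_{k+1}` of the slot number `k + 1`. -/
def posO {t : ℕ} (k : Fin t) : Fin (2 * t + 2) := ⟨2 * k + 2, by omega⟩

/-- Position of `F`. -/
def posF (t : ℕ) : Fin (2 * t + 2) := ⟨2 * t + 1, by omega⟩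

/-- The multi-index with entry `p` on `P`, entries `w` on `I_1, O_1, …, I_t, O_t`, and `f` on `F`. -/
def causalIdx {d t : ℕ} (p : Fin d) (w : Idx d (2 * t)) (f : Fin d) : Idx d (2 * t + 2) := fun l =>
  if h0 : (l : ℕ) = 0 then p
  else if h : (l : ℕ) < 2 * t + 1 then w ⟨l - 1, by omega⟩ else f

/-! ## The original semidefinite program -/

/-- The vector `|U⟩⟩ = (1 ⊗ U) ∑_k e_k ⊗ e_k`. -/
def choiVec {d : ℕ} (U : Matrix (Fin d) (Fin d) ℂ) : Fin d × Fin d → ℂ :=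
  ((1 : Matrix (Fin d) (Fin d) ℂ) ⊗ₖ U).mulVec (fun q => if q.1 = q.2 then 1 else 0)

/-- The Choi operator `|U⟩⟩⟨⟨U|`. -/
def choiOp {d : ℕ} (U : Matrix (Fin d) (Fin d) ℂ) : Matrix (Fin d × Fin d) (Fin d × Fin d) ℂ :=
  Matrix.vecMulVec (choiVec U) (star (choiVec U))

/-- The operator `1_P ⊗ |U⟩⟩⟨⟨U|_{IO}^{⊗ t} ⊗ 1_F`, the `k`-th factor being on `I_k ⊗ O_k`. -/
def slotsOp {d : ℕ} (t : ℕ) (U : Matrix (Fin d) (Fin d) ℂ) : TOp d (2 * t + 2) :=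
  Matrix.of fun i j =>
    (1 : Matrix (Fin d) (Fin d) ℂ) (i (posP t)) (j (posP t)) *
    (∏ k : Fin t, choiOp U (i (posI k), i (posO k)) (j (posI k), j (posO k))) *
    (1 : Matrix (Fin d) (Fin d) ℂ) (i (posF t)) (j (posF t))

/-- The partial transpose `C^{T_{IO}}` on all the systems but `P` and `F`. -/
def transposeIO {d t : ℕ} (C : TOp d (2 * t + 2)) : TOp d (2 * t + 2) :=
  Matrix.of fun i j =>
    C (fun l => if l = posP t ∨ l = posF t then i l else j l)
      (fun l => if l = posP t ∨ l = posF t then j l else i l)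

/-- The partial trace over `I_1, O_1, …, I_t, O_t`, an operator on `P ⊗ F`. -/
def traceIO {d t : ℕ} (A : TOp d (2 * t + 2)) : Matrix (Fin d × Fin d) (Fin d × Fin d) ℂ :=
  Matrix.of fun x y => ∑ w : Idx d (2 * t), A (causalIdx x.1 w x.2) (causalIdx y.1 w y.2)

/-- The link product `C * |U⟩⟩⟨⟨U|^{⊗ t} = Tr_{IO}[C^{T_{IO}} (1_P ⊗ |U⟩⟩⟨⟨U|^{⊗ t} ⊗ 1_F)]`,
an operator on `P ⊗ F`. -/
def linkU {d t : ℕ} (C : TOp d (2 * t + 2)) (U : Matrix (Fin d) (Fin d) ℂ) :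
    Matrix (Fin d × Fin d) (Fin d × Fin d) ℂ :=
  traceIO (transposeIO C * slotsOp t U)

/-- The switch operator `|b⟩ ⊗ |a⟩ ↦ |a⟩ ⊗ |b⟩`. -/
def switchOp (d : ℕ) : Matrix (Fin d × Fin d) (Fin d × Fin d) ℂ :=
  Matrix.of fun x y => if x = y.swap then 1 else 0

/-- The partial trace over the first tensor factor. -/
def traceFst {d : ℕ} (A : Matrix (Fin d × Fin d) (Fin d × Fin d) ℂ) : Matrix (Fin d) (Fin d) ℂ :=
  Matrix.of fun p q => ∑ f, A (f, p) (f, q)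

/-- The operator `Tr_F[F (C * |U⟩⟩⟨⟨U|^{⊗ t})^T F (O_F^T ⊗ 1_P) - |U⟩⟩⟨⟨U|_{FP} (O_F^T ⊗ 1_P)]`. -/
def deviation {d t : ℕ} (O : Matrix (Fin d) (Fin d) ℂ) (C : TOp d (2 * t + 2))
    (U : Matrix (Fin d) (Fin d) ℂ) : Matrix (Fin d) (Fin d) ℂ :=
  traceFst (switchOp d * (linkU C U).transpose * switchOp d *
      (O.transpose ⊗ₖ (1 : Matrix (Fin d) (Fin d) ℂ)) -
    choiOp U * (O.transpose ⊗ₖ (1 : Matrix (Fin d) (Fin d) ℂ)))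

/-- The target function of the original program. -/
def objective {d t : ℕ} (O : Matrix (Fin d) (Fin d) ℂ) (C : TOp d (2 * t + 2)) : ℝ :=
  ∫ U : UGroup d, frobNorm (deviation O C (U : Matrix (Fin d) (Fin d) ℂ)) ∂(haarU d)

/-- The constraints of the original program, i.e. those of a sequential quantum comb with `t` slots:
`C ⪰ 0`, `Tr_F C = Tr_{O_t F} C ⊗ 1/d`, `Tr_{I_t O_t F} C = Tr_{O_{t-1} I_t O_t F} C ⊗ 1/d`, …,
`Tr_{I_1 ⋯ F} C = Tr_{P I_1 ⋯ F} C ⊗ 1/d`, and `Tr C = d^{t+1}`. In the equation number `s` the left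
side keeps the first `2 s + 1` systems. -/
structure IsFeasible {d t : ℕ} (C : TOp d (2 * t + 2)) : Prop where
  posSemidef : C.PosSemidef
  comb : ∀ s : ℕ, s ≤ t →
    tailTrace (2 * s + 1) C =
      tensorLast (tailTrace (2 * s) C) ((1 / (d : ℂ)) • (1 : Matrix (Fin d) (Fin d) ℂ))
  trace_eq : C.trace = (d : ℂ) ^ (t + 1)

/-- The symmetry `[C, U ⊗ (V ⊗ U)^{⊗ t} ⊗ W] = 0` for all `U ∈ U(d)` and `V, W ∈ C_O`, in the causal
order of the systems. -/
def IsSymmetric {d t : ℕ} (O : Matrix (Fin d) (Fin d) ℂ) (C : TOp d (2 * t + 2)) : Prop :=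
  ∀ (U : UGroup d) (V W : centralizerU O),
    Commute C (tensorOp fun l : Fin (2 * t + 2) =>
      if l = posF t then (W : Matrix (Fin d) (Fin d) ℂ)
      else if Even (l : ℕ) then (U : Matrix (Fin d) (Fin d) ℂ)
      else (V : Matrix (Fin d) (Fin d) ℂ))

/-! ## The representation `(U, V, W) ↦ U^{⊗ t+1} ⊗ V^{⊗ t} ⊗ W` and its Schur bases -/

/-- The group `U(d) × C_O × C_O`. -/
abbrev SymGroup {d : ℕ} (O : Matrix (Fin d) (Fin d) ℂ) : Type :=
  UGroup d × centralizerU O × centralizerU O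

/-- The operator `U^{⊗ t+1} ⊗ V^{⊗ t} ⊗ W`, in the grouped order `P, O_1, …, O_t, I_1, …, I_t, F`. -/
def groupedRep {d : ℕ} (t : ℕ) {O : Matrix (Fin d) (Fin d) ℂ} (g : SymGroup O) :
    TOp d (2 * t + 2) :=
  tensorOp fun l : Fin (2 * t + 2) =>
    if (l : ℕ) < t + 1 then (g.1 : Matrix (Fin d) (Fin d) ℂ)
    else if (l : ℕ) < 2 * t + 1 then (g.2.1 : Matrix (Fin d) (Fin d) ℂ)
    else (g.2.2 : Matrix (Fin d) (Fin d) ℂ)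

/-- A Schur unitary matrix `Q` for `U^{⊗ t+1} ⊗ V^{⊗ t} ⊗ W`. Its columns `v_{r,a,α}` are labelled by
an irreducible constituent `r`, by `a ∈ [dim V_r]` and by `α ∈ [m_r]`, and `Q† ρ(g) Q` is the direct
sum over `r` of the irreducible representation `ρ^r`, repeated `m_r` times. -/
structure SchurBasis (d t : ℕ) (O : Matrix (Fin d) (Fin d) ℂ) where
  /-- the number of inequivalent irreducible constituents -/
  numIrr : ℕ
  /-- `dim V_r` -/
  dim : Fin numIrr → ℕ
  /-- the multiplicity `m_r` -/
  mult : Fin numIrr → ℕ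
  mult_pos : ∀ r, 0 < mult r
  /-- the irreducible representations `ρ^r` -/
  irr : ∀ r, Representation ℂ (SymGroup O) (Fin (dim r) → ℂ)
  irreducible : ∀ r, (irr r).IsIrreducible
  inequivalent : ∀ r s, r ≠ s → IsEmpty ((irr r).Equiv (irr s))
  /-- the Schur matrix -/
  Q : Matrix (Idx d (2 * t + 2)) (Σ r : Fin numIrr, Fin (dim r) × Fin (mult r)) ℂ
  conjTranspose_mul : Q.conjTranspose * Q = 1
  mul_conjTranspose : Q * Q.conjTranspose = 1
  blockDiagonal : ∀ g : SymGroup O,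
    Q.conjTranspose * groupedRep t g * Q =
      Matrix.blockDiagonal' fun r =>
        LinearMap.toMatrix' (irr r g) ⊗ₖ (1 : Matrix (Fin (mult r)) (Fin (mult r)) ℂ)

/-- `π` sends the positions of the causal order `P, I_1, O_1, …, I_t, O_t, F` to those of a grouped
order `P, O_1, …, O_t, I_1, …, I_t, F`, with any order among the `O_k` and among the `I_k`. -/
structure IsGrouping (t : ℕ) (π : Equiv.Perm (Fin (2 * t + 2))) : Prop where
  map_P : π (posP t) = posP t
  map_O : ∀ k : Fin t, 1 ≤ (π (posO k) : ℕ) ∧ (π (posO k) : ℕ) ≤ t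
  map_I : ∀ k : Fin t, t + 1 ≤ (π (posI k) : ℕ) ∧ (π (posI k) : ℕ) ≤ 2 * t
  map_F : π (posF t) = posF t

/-- `P_π(i_1, …, i_n) = (i_{π⁻¹(1)}, …, i_{π⁻¹(n)})`. -/
def permIdx {d n : ℕ} (π : Equiv.Perm (Fin n)) (i : Idx d n) : Idx d n := fun l => i (π.symm l)

namespace SchurBasis

variable {d t : ℕ} {O : Matrix (Fin d) (Fin d) ℂ}

/-- The coefficient `p^{r,a,α}_{i_1,…,i_{2t+2}}` of `v_{r,a,α}` in the computational basis. -/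
def p (S : SchurBasis d t O) (r : Fin S.numIrr) (a : Fin (S.dim r)) (α : Fin (S.mult r))
    (i : Idx d (2 * t + 2)) : ℂ := S.Q i ⟨r, (a, α)⟩

/-- The variables of the reduced program: a matrix `C^(r)` of size `m_r × m_r` for every `r`. -/
abbrev Blocks (S : SchurBasis d t O) : Type :=
  ∀ r : Fin S.numIrr, Matrix (Fin (S.mult r)) (Fin (S.mult r)) ℂ

/-- The operator `C`, in the causal order of the systems, with
`P_π C P_π† = ∑_r ∑_{α,β} c^(r)_{α,β} ∑_a |v_{r,a,α}⟩⟨v_{r,a,β}|`. -/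
def assemble (S : SchurBasis d t O) (π : Equiv.Perm (Fin (2 * t + 2))) (X : S.Blocks) :
    TOp d (2 * t + 2) :=
  Matrix.of fun i j => ∑ r, ∑ α, ∑ β, ∑ a,
    X r α β * S.p r a α (permIdx π i) * star (S.p r a β (permIdx π j))

/-! In the following definitions `m = 2 t + 2 - K` is the number of systems in `R_K`; the multi-index
`(i_{R_K}, x, i_{K-1})` is `glue (Fin.snoc i x) z`. -/

open scoped Classical in
/-- `Supp_{r,K}^π(i_{R_K}, x)`. -/
def supp (S : SchurBasis d t O) (π : Equiv.Perm (Fin (2 * t + 2))) (r : Fin S.numIrr) (m : ℕ)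
    (ix : Idx d m × Fin d) : Finset (Fin (S.dim r) × Idx d (2 * t + 2 - (m + 1))) :=
  Finset.univ.filter fun q =>
    ∃ α, S.p r q.1 α (permIdx π (glue (Fin.snoc ix.1 ix.2 : Idx d (m + 1)) q.2)) ≠ 0

/-- `S_{r,K}^π`. -/
def suppSet (S : SchurBasis d t O) (π : Equiv.Perm (Fin (2 * t + 2))) (r : Fin S.numIrr) (m : ℕ) :
    Set (Idx d m × Fin d) :=
  {ix | (S.supp π r m ix).Nonempty}

open scoped Classical in
/-- `S_K^π`. -/
def pairSet (S : SchurBasis d t O) (π : Equiv.Perm (Fin (2 * t + 2))) (m : ℕ) :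
    Set ((Idx d m × Fin d) × (Idx d m × Fin d)) :=
  ⋃ r : Fin S.numIrr, {q | q ∈ S.suppSet π r m ×ˢ S.suppSet π r m ∧
    (S.supp π r m q.1 ∩ S.supp π r m q.2).Nonempty}

open scoped Classical in
/-- `M_K^{r,π}(i_{R_K}, x, j_{R_K}, y)`. It is zero if the two supports do not meet. -/
def MK (S : SchurBasis d t O) (π : Equiv.Perm (Fin (2 * t + 2))) (r : Fin S.numIrr) (m : ℕ)
    (ix jy : Idx d m × Fin d) : Matrix (Fin (S.mult r)) (Fin (S.mult r)) ℂ :=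
  Matrix.of fun β α => ∑ q ∈ S.supp π r m ix ∩ S.supp π r m jy,
    S.p r q.1 α (permIdx π (glue (Fin.snoc ix.1 ix.2 : Idx d (m + 1)) q.2)) *
      star (S.p r q.1 β (permIdx π (glue (Fin.snoc jy.1 jy.2 : Idx d (m + 1)) q.2)))

open scoped Classical in
/-- `N(r,a,α,π,i)`: the tuples `(i_2, …, i_{2t+2})` with `p^{r,a,α}_{P_π(i, i_2, …, i_{2t+2})} ≠ 0`. -/
def nonzeroTails (S : SchurBasis d t O) (π : Equiv.Perm (Fin (2 * t + 2))) (r : Fin S.numIrr)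
    (a : Fin (S.dim r)) (α : Fin (S.mult r)) (i : Fin d) : Finset (Idx d (2 * t + 1)) :=
  Finset.univ.filter fun w => S.p r a α (permIdx π (Fin.cons i w : Idx d (2 * t + 2))) ≠ 0

/-- `M_{U,O}^{r,π}(j_1, i_1)`. -/
def MU (S : SchurBasis d t O) (π : Equiv.Perm (Fin (2 * t + 2))) (U : Matrix (Fin d) (Fin d) ℂ)
    (r : Fin S.numIrr) (j₁ i₁ : Fin d) : Matrix (Fin (S.mult r)) (Fin (S.mult r)) ℂ :=
  Matrix.of fun β α => ∑ a, ∑ v ∈ S.nonzeroTails π r a α i₁, ∑ w ∈ S.nonzeroTails π r a β j₁,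
    let i : Idx d (2 * t + 2) := Fin.cons i₁ v
    let j : Idx d (2 * t + 2) := Fin.cons j₁ w
    S.p r a α (permIdx π i) * star (S.p r a β (permIdx π j)) *
      (∏ k : Fin t, U (i (posO k)) (i (posI k)) * star (U (j (posO k)) (j (posI k)))) *
      (Matrix.single (j (posF t)) (i (posF t)) (1 : ℂ) * O.transpose).trace

/-- The target function of the reduced program. -/
def reducedObjective (S : SchurBasis d t O) (π : Equiv.Perm (Fin (2 * t + 2))) (X : S.Blocks) : ℝ :=
  ∫ U : UGroup d, frobNorm
    ((∑ r, ∑ i₁ : Fin d, ∑ j₁ : Fin d,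
        (X r * S.MU π (U : Matrix (Fin d) (Fin d) ℂ) r j₁ i₁).trace •
          Matrix.single j₁ i₁ (1 : ℂ)) -
      (U : Matrix (Fin d) (Fin d) ℂ) * O * (U : Matrix (Fin d) (Fin d) ℂ).conjTranspose)
    ∂(haarU d)

/-- The constraints of the reduced program; `m = 2 s` stands for `K = 2 t + 2 - 2 s`, which runs
through `{2, 4, …, 2 t + 2}`. -/
structure IsReducedFeasible (S : SchurBasis d t O) (π : Equiv.Perm (Fin (2 * t + 2)))
    (X : S.Blocks) : Prop where
  posSemidef : ∀ r, (X r).PosSemidef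
  comb : ∀ s : ℕ, s ≤ t → ∀ (i j : Idx d (2 * s)) (x y : Fin d),
    ((i, x), (j, y)) ∈ S.pairSet π (2 * s) →
      ∑ r, (X r * S.MK π r (2 * s) (i, x) (j, y)).trace =
        (if x = y then 1 else 0) / (d : ℂ) *
          ∑ z : Fin d, ∑ r, (X r * S.MK π r (2 * s) (i, z) (j, z)).trace
  trace_eq : ∑ r, (S.dim r : ℂ) * (X r).trace = (d : ℂ) ^ (t + 1)

end SchurBasis

end ShadowInversion

end

open ShadowInversion

/-!
The operators commuting with `U ⊗ (V ⊗ U)^{⊗ t} ⊗ W` form the commutant of a unitary representation,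
so in a Schur basis Schur's lemma turns them into `⊕_r 1 ⊗ C^(r)` (`SchurBasis.bijOn_assemble`). A
Schur basis exists because a unitary representation is an orthogonal sum of irreducible ones, and
equivalent irreducible unitary representations are unitarily equivalent (`nonempty_schurBasis`). No
continuity of the representation is needed.

Under this parametrization positivity and the trace are read off blockwise. The left sides of the
reduced constraints are the entries of the partial traces of `C`, and the two target functions agree
at every `U`. One point needs an argument: the reduced program imposes a comb constraint only on the
pairs in `S_K^π`. Off that set all the matrices `M_K^{r,π}` vanish, and so do the corresponding entries
of the partial trace of every symmetric operator. Applied to the symmetric operator `Tr_K C ⊗ 1`, this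
shows that the right side of a missing constraint vanishes as well
(`SchurBasis.tailTrace_eq_zero_of_notMem_pairSet`).

The feasible set of the original program is compact and convex, and the target function is continuous
and convex. Both are invariant under `C ↦ g C g†` for `g` in the symmetry group: this transformation
replaces `U` by `U₀ᵀ U V`, and the Haar measure is invariant on both sides (`objective_conj`). Instead
of averaging a minimizer over the group, the proof takes the minimizer of least Frobenius norm. By
strict convexity of the squared norm it is unique, hence fixed by the group
(`exists_symmetric_minimizer`). It is therefore the image of a family of blocks, and the two minima
coincide.
-/

namespace ShadowInversion

open Matrix

/-! ### Unitary matrix representations -/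

/-- The representation on column vectors given by a multiplicative family of matrices. -/
noncomputable def matRep {G : Type*} [Group G] {n : ℕ} (σ : G →* Matrix (Fin n) (Fin n) ℂ) :
    Representation ℂ G (Fin n → ℂ) :=
  (Matrix.toLinAlgEquiv' : Matrix (Fin n) (Fin n) ℂ ≃ₐ[ℂ] _).toAlgHom.toMonoidHom.comp σ

section Reps

variable {G : Type*} [Group G]

lemma toMatrix'_matRep {n : ℕ} (σ : G →* Matrix (Fin n) (Fin n) ℂ) (g : G) :
    LinearMap.toMatrix' (matRep σ g) = σ g :=
  LinearMap.toMatrix'_toLin' (σ g)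

/-- Schur's lemma for one irreducible representation, in matrix form. -/
lemma exists_eq_smul_one_of_intertwines {n : ℕ} (τ : Representation ℂ G (Fin n → ℂ))
    (hτ : τ.IsIrreducible) (A : Matrix (Fin n) (Fin n) ℂ)
    (hA : ∀ g, LinearMap.toMatrix' (τ g) * A = A * LinearMap.toMatrix' (τ g)) :
    ∃ c : ℂ, A = c • 1 := by
  have : τ.IsIrreducible := hτ
  let f : Representation.IntertwiningMap τ τ := ⟨Matrix.toLin' A, by
    intro g
    apply LinearMap.toMatrix'.injective
    rw [LinearMap.toMatrix'_comp, LinearMap.toMatrix'_comp, LinearMap.toMatrix'_toLin', hA]⟩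
  obtain ⟨c, hc⟩ :=
    (Representation.IsIrreducible.algebraMap_intertwiningMap_bijective_of_isAlgClosed
      (ρ := τ)).2 f
  refine ⟨c, ?_⟩
  have h1 : f.toLinearMap = c • LinearMap.id := by
    rw [← hc]; rfl
  have h2 : Matrix.toLin' A = c • LinearMap.id := h1
  apply Matrix.toLin'.injective
  rw [h2, map_smul, Matrix.toLin'_one]

/-- Schur's lemma for two inequivalent irreducible representations, in matrix form. -/
lemma eq_zero_of_intertwines {m n : ℕ} (τ : Representation ℂ G (Fin m → ℂ))
    (τ' : Representation ℂ G (Fin n → ℂ)) (hτ : τ.IsIrreducible) (hτ' : τ'.IsIrreducible)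
    (hne : IsEmpty (τ.Equiv τ')) (A : Matrix (Fin n) (Fin m) ℂ)
    (hA : ∀ g, LinearMap.toMatrix' (τ' g) * A = A * LinearMap.toMatrix' (τ g)) :
    A = 0 := by
  let f : Representation.IntertwiningMap τ τ' := ⟨Matrix.toLin' A, by
    intro g
    apply LinearMap.toMatrix'.injective
    rw [LinearMap.toMatrix'_comp, LinearMap.toMatrix'_comp, LinearMap.toMatrix'_toLin', hA]⟩
  have h0 : f = 0 := Subsingleton.elim _ _
  have h1 : Matrix.toLin' A = 0 := congrArg Representation.IntertwiningMap.toLinearMap h0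
  exact (LinearEquiv.map_eq_zero_iff _).1 h1

lemma dim_pos_of_isIrreducible {n : ℕ} (τ : Representation ℂ G (Fin n → ℂ))
    (hτ : τ.IsIrreducible) : 0 < n := by
  rcases Nat.eq_zero_or_pos n with rfl | h
  · exfalso
    obtain ⟨a, b, hab⟩ := hτ.toNontrivial
    apply hab
    apply Subrepresentation.toSubmodule_injective
    exact Subsingleton.elim _ _
  · exact h

/-- The compression of a matrix representation to the invariant range of an isometry `A`. -/
def compress {X Y : Type*} [Fintype X] [DecidableEq X] [Fintype Y] [DecidableEq Y]
    (ρ : G →* Matrix X X ℂ) (A : Matrix X Y ℂ) (hA : Aᴴ * A = 1)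
    (hinv : ∀ g, A * (Aᴴ * ρ g * A) = ρ g * A) : G →* Matrix Y Y ℂ where
  toFun g := Aᴴ * ρ g * A
  map_one' := by simp [hA]
  map_mul' g h := by
    calc Aᴴ * ρ (g * h) * A = Aᴴ * ρ g * (ρ h * A) := by simp only [map_mul, Matrix.mul_assoc]
      _ = Aᴴ * ρ g * (A * (Aᴴ * ρ h * A)) := by rw [hinv]
      _ = _ := by simp only [Matrix.mul_assoc]

/-- A subspace of `ℂ^N` and its orthogonal complement are the ranges of two isometries whose range
projections add up to the identity. -/
lemma exists_isometries_of_submodule {N : ℕ} (W : Submodule ℂ (EuclideanSpace ℂ (Fin N))) :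
    ∃ (A : Matrix (Fin N) (Fin (Module.finrank ℂ W)) ℂ)
      (B : Matrix (Fin N) (Fin (Module.finrank ℂ Wᗮ)) ℂ),
      Aᴴ * A = 1 ∧ Bᴴ * B = 1 ∧ Aᴴ * B = 0 ∧ A * Aᴴ + B * Bᴴ = 1 ∧
      (∀ k, WithLp.toLp 2 (fun x => A x k) ∈ W) ∧ (∀ k, WithLp.toLp 2 (fun x => B x k) ∈ Wᗮ) := by
  let a := stdOrthonormalBasis ℂ W
  let b := stdOrthonormalBasis ℂ Wᗮ
  let A : Matrix (Fin N) (Fin (Module.finrank ℂ W)) ℂ :=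
    Matrix.of fun x k => (a k : EuclideanSpace ℂ (Fin N)) x
  let B : Matrix (Fin N) (Fin (Module.finrank ℂ Wᗮ)) ℂ :=
    Matrix.of fun x k => (b k : EuclideanSpace ℂ (Fin N)) x
  have hin : ∀ u v : EuclideanSpace ℂ (Fin N), ∑ x, star (u x) * v x = inner ℂ u v := by
    intro u v
    simp [PiLp.inner_apply, mul_comm]
  have hA : Aᴴ * A = 1 := by
    ext k l
    rw [Matrix.mul_apply, Matrix.one_apply]
    refine (hin _ _).trans ?_
    have := orthonormal_iff_ite.1 a.orthonormal k l
    rwa [Submodule.coe_inner] at this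
  have hB : Bᴴ * B = 1 := by
    ext k l
    rw [Matrix.mul_apply, Matrix.one_apply]
    refine (hin _ _).trans ?_
    have := orthonormal_iff_ite.1 b.orthonormal k l
    rwa [Submodule.coe_inner] at this
  have hAB : Aᴴ * B = 0 := by
    ext k l
    rw [Matrix.mul_apply]
    refine (hin _ _).trans ?_
    exact (Submodule.mem_orthogonal _ _).1 (b l).2 _ (a k).2
  have hBA : Bᴴ * A = 0 := by
    have := congrArg Matrix.conjTranspose hAB
    simpa using this
  refine ⟨A, B, hA, hB, hAB, ?_, fun k => (a k).2, fun k => (b k).2⟩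
  have hcard : Fintype.card (Fin N) =
      Fintype.card (Fin (Module.finrank ℂ W) ⊕ Fin (Module.finrank ℂ Wᗮ)) := by
    have := W.finrank_add_finrank_orthogonal
    simp only [finrank_euclideanSpace, Fintype.card_fin] at this
    simp [this]
  have h1 : (Matrix.fromCols A B)ᴴ * Matrix.fromCols A B = 1 := by
    rw [Matrix.conjTranspose_fromCols_eq_fromRows_conjTranspose, Matrix.fromRows_mul_fromCols,
      hA, hB, hAB, hBA, Matrix.fromBlocks_one]
  have h2 := (Matrix.mul_eq_one_comm_of_card_eq _ _ _ hcard.symm).1 h1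
  rwa [Matrix.conjTranspose_fromCols_eq_fromRows_conjTranspose, Matrix.fromCols_mul_fromRows] at h2

/-- Complete reducibility: a unitary matrix representation is an orthogonal direct sum of
irreducible ones, `J i` being the isometric embedding of the `i`-th summand. -/
theorem exists_irreducible_decomposition (N : ℕ) (ρ : G →* Matrix (Fin N) (Fin N) ℂ)
    (hρ : ∀ g, (ρ g)ᴴ * ρ g = 1) :
    ∃ (ι : Type) (_ : Fintype ι) (n : ι → ℕ) (σ : ∀ i, G →* Matrix (Fin (n i)) (Fin (n i)) ℂ)
      (J : ∀ i, Matrix (Fin N) (Fin (n i)) ℂ),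
      (∀ i, (matRep (σ i)).IsIrreducible) ∧ (∀ i, (J i)ᴴ * J i = 1) ∧
      (∀ i j, i ≠ j → (J i)ᴴ * J j = 0) ∧ ∑ i, J i * (J i)ᴴ = 1 ∧
      ∀ i g, ρ g * J i = J i * σ i g := by
  induction N using Nat.strong_induction_on with
  | _ N ih =>
  rcases Nat.eq_zero_or_pos N with rfl | hN
  · exact ⟨Empty, inferInstance, fun i => i.elim, fun i => i.elim, fun i => i.elim,
      fun i => i.elim, fun i => i.elim, fun i => i.elim, Subsingleton.elim _ _, fun i => i.elim⟩
  by_cases hirr : (matRep ρ).IsIrreducible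
  · exact ⟨Unit, inferInstance, fun _ => N, fun _ => ρ, fun _ => 1, fun _ => hirr,
      fun _ => by simp, fun i j h => absurd (Subsingleton.elim i j) h, by simp, by simp⟩
  have hnt : Nontrivial (Subrepresentation (matRep ρ)) := by
    refine ⟨⊥, ⊤, fun h => ?_⟩
    have h' : (⊥ : Submodule ℂ (Fin N → ℂ)) = ⊤ := congrArg Subrepresentation.toSubmodule h
    have : Nonempty (Fin N) := ⟨⟨0, hN⟩⟩
    exact bot_ne_top h'
  obtain ⟨S, hS⟩ : ∃ S : Subrepresentation (matRep ρ), ¬ (S = ⊥ ∨ S = ⊤) := by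
    by_contra hcon
    simp only [not_exists, not_not] at hcon
    exact hirr ⟨fun S => by
      by_cases h : S = ⊥
      · exact Or.inl h
      · exact Or.inr ((hcon S).resolve_left h)⟩
  push Not at hS
  let e := WithLp.linearEquiv 2 ℂ (Fin N → ℂ)
  let W : Submodule ℂ (EuclideanSpace ℂ (Fin N)) := S.toSubmodule.comap e.toLinearMap
  have hWinv : ∀ g v, WithLp.toLp 2 v ∈ W → WithLp.toLp 2 (ρ g *ᵥ v) ∈ W := fun g v hv =>
    S.apply_mem_toSubmodule g hv
  have hWbot : W ≠ ⊥ := by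
    intro h
    apply hS.1
    apply Subrepresentation.toSubmodule_injective
    refine (Submodule.eq_bot_iff _).2 fun v hv => ?_
    have h1 : WithLp.toLp 2 v ∈ W := hv
    rw [h, Submodule.mem_bot] at h1
    simpa using h1
  have hWtop : W ≠ ⊤ := by
    intro h
    apply hS.2
    apply Subrepresentation.toSubmodule_injective
    refine (Submodule.eq_top_iff').2 fun v => ?_
    have h1 : WithLp.toLp 2 v ∈ W := by rw [h]; trivial
    exact h1
  have hsum := W.finrank_add_finrank_orthogonal
  rw [finrank_euclideanSpace, Fintype.card_fin] at hsum
  have hlt : Module.finrank ℂ W < N := by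
    have := Submodule.finrank_lt hWtop
    rwa [finrank_euclideanSpace, Fintype.card_fin] at this
  have hpos : 0 < Module.finrank ℂ W :=
    Nat.pos_of_ne_zero fun h => hWbot (Submodule.finrank_eq_zero.1 h)
  obtain ⟨A, B, hA, hB, hAB, hone, hAW, hBW⟩ := exists_isometries_of_submodule W
  have hBA : Bᴴ * A = 0 := by
    have := congrArg Matrix.conjTranspose hAB
    simpa using this
  -- `W` is invariant, and so is its complement because `ρ` is unitary.
  have hBρA : ∀ g, Bᴴ * (ρ g * A) = 0 := by
    intro g
    ext l k
    have h1 := hWinv g _ (hAW k)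
    have h2 := (Submodule.mem_orthogonal' _ _).1 (hBW l) _ h1
    rw [Matrix.mul_apply, Matrix.zero_apply, ← h2]
    simp only [PiLp.inner_apply, Matrix.conjTranspose_apply]
    refine Finset.sum_congr rfl fun x _ => ?_
    rw [RCLike.inner_apply, mul_comm]
    rfl
  have hinvρ : ∀ g, (ρ g)ᴴ = ρ g⁻¹ := by
    intro g
    calc (ρ g)ᴴ = (ρ g)ᴴ * (ρ g * ρ g⁻¹) := by rw [← map_mul]; simp
      _ = ρ g⁻¹ := by rw [← Matrix.mul_assoc, hρ, Matrix.one_mul]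
  have hAρB : ∀ g, Aᴴ * (ρ g * B) = 0 := by
    intro g
    have := congrArg Matrix.conjTranspose (hBρA g⁻¹)
    rw [← hinvρ] at this
    simpa [Matrix.mul_assoc] using this
  have hinvA : ∀ g, A * (Aᴴ * ρ g * A) = ρ g * A := by
    intro g
    calc A * (Aᴴ * ρ g * A) = (A * Aᴴ + B * Bᴴ) * (ρ g * A) - B * (Bᴴ * (ρ g * A)) := by
          simp only [Matrix.add_mul, Matrix.mul_assoc, add_sub_cancel_right]
      _ = ρ g * A := by rw [hone, hBρA]; simp
  have hinvB : ∀ g, B * (Bᴴ * ρ g * B) = ρ g * B := by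
    intro g
    calc B * (Bᴴ * ρ g * B) = (A * Aᴴ + B * Bᴴ) * (ρ g * B) - A * (Aᴴ * (ρ g * B)) := by
          simp only [Matrix.add_mul, Matrix.mul_assoc, add_sub_cancel_left]
      _ = ρ g * B := by rw [hone, hAρB]; simp
  have hunit : ∀ {m : ℕ} (C : Matrix (Fin N) (Fin m) ℂ) (hC : Cᴴ * C = 1)
      (hCi : ∀ g, C * (Cᴴ * ρ g * C) = ρ g * C) (g : G),
      (compress ρ C hC hCi g)ᴴ * compress ρ C hC hCi g = 1 := by
    intro m C hC hCi g
    change (Cᴴ * ρ g * C)ᴴ * (Cᴴ * ρ g * C) = 1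
    calc (Cᴴ * ρ g * C)ᴴ * (Cᴴ * ρ g * C) = Cᴴ * (ρ g)ᴴ * (C * (Cᴴ * ρ g * C)) := by
          simp [Matrix.mul_assoc]
      _ = Cᴴ * ((ρ g)ᴴ * ρ g) * C := by rw [hCi]; simp only [Matrix.mul_assoc]
      _ = 1 := by rw [hρ]; simp [hC]
  obtain ⟨ι₁, _, n₁, σ₁, J₁, irr₁, iso₁, orth₁, sum₁, int₁⟩ :=
    ih _ hlt (compress ρ A hA hinvA) (hunit A hA hinvA)
  obtain ⟨ι₂, _, n₂, σ₂, J₂, irr₂, iso₂, orth₂, sum₂, int₂⟩ :=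
    ih _ (by omega) (compress ρ B hB hinvB) (hunit B hB hinvB)
  refine ⟨ι₁ ⊕ ι₂, inferInstance, Sum.elim n₁ n₂,
    fun i => match i with | .inl i => σ₁ i | .inr i => σ₂ i,
    fun i => match i with | .inl i => A * J₁ i | .inr i => B * J₂ i, ?_, ?_, ?_, ?_, ?_⟩
  · rintro (i | i)
    exacts [irr₁ i, irr₂ i]
  · rintro (i | i)
    · change (A * J₁ i)ᴴ * (A * J₁ i) = 1
      rw [Matrix.conjTranspose_mul, Matrix.mul_assoc, ← Matrix.mul_assoc Aᴴ, hA, Matrix.one_mul,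
        iso₁]
    · change (B * J₂ i)ᴴ * (B * J₂ i) = 1
      rw [Matrix.conjTranspose_mul, Matrix.mul_assoc, ← Matrix.mul_assoc Bᴴ, hB, Matrix.one_mul,
        iso₂]
  · rintro (i | i) (j | j) hij
    · change (A * J₁ i)ᴴ * (A * J₁ j) = 0
      rw [Matrix.conjTranspose_mul, Matrix.mul_assoc, ← Matrix.mul_assoc Aᴴ, hA, Matrix.one_mul,
        orth₁ _ _ fun h => hij (congrArg _ h)]
    · change (A * J₁ i)ᴴ * (B * J₂ j) = 0
      rw [Matrix.conjTranspose_mul, Matrix.mul_assoc, ← Matrix.mul_assoc Aᴴ, hAB, Matrix.zero_mul,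
        Matrix.mul_zero]
    · change (B * J₂ i)ᴴ * (A * J₁ j) = 0
      rw [Matrix.conjTranspose_mul, Matrix.mul_assoc, ← Matrix.mul_assoc Bᴴ, hBA, Matrix.zero_mul,
        Matrix.mul_zero]
    · change (B * J₂ i)ᴴ * (B * J₂ j) = 0
      rw [Matrix.conjTranspose_mul, Matrix.mul_assoc, ← Matrix.mul_assoc Bᴴ, hB, Matrix.one_mul,
        orth₂ _ _ fun h => hij (congrArg _ h)]
  · rw [Fintype.sum_sum_type]
    change ∑ i, A * J₁ i * (A * J₁ i)ᴴ + ∑ i, B * J₂ i * (B * J₂ i)ᴴ = 1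
    have e1 : ∑ i, A * J₁ i * (A * J₁ i)ᴴ = A * (∑ i, J₁ i * (J₁ i)ᴴ) * Aᴴ := by
      simp only [Matrix.mul_sum, Matrix.sum_mul, Matrix.conjTranspose_mul, Matrix.mul_assoc]
    have e2 : ∑ i, B * J₂ i * (B * J₂ i)ᴴ = B * (∑ i, J₂ i * (J₂ i)ᴴ) * Bᴴ := by
      simp only [Matrix.mul_sum, Matrix.sum_mul, Matrix.conjTranspose_mul, Matrix.mul_assoc]
    rw [e1, e2, sum₁, sum₂, Matrix.mul_one, Matrix.mul_one, hone]
  · rintro (i | i) g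
    · change ρ g * (A * J₁ i) = A * J₁ i * σ₁ i g
      rw [Matrix.mul_assoc, ← int₁, ← Matrix.mul_assoc, ← hinvA, Matrix.mul_assoc]
      rfl
    · change ρ g * (B * J₂ i) = B * J₂ i * σ₂ i g
      rw [Matrix.mul_assoc, ← int₂, ← Matrix.mul_assoc, ← hinvB, Matrix.mul_assoc]
      rfl

/-- Equivalent irreducible unitary representations are unitarily equivalent: for an intertwiner `T`
the matrix `Tᴴ T` is a positive scalar by Schur's lemma, so a multiple of `T` is unitary. -/
lemma exists_unitary_intertwiner {m n : ℕ} (σ : G →* Matrix (Fin m) (Fin m) ℂ)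
    (τ : G →* Matrix (Fin n) (Fin n) ℂ) (hσ : ∀ g, (σ g)ᴴ * σ g = 1) (hτ : ∀ g, (τ g)ᴴ * τ g = 1)
    (hirr : (matRep σ).IsIrreducible) (φ : (matRep σ).Equiv (matRep τ)) :
    ∃ T : Matrix (Fin n) (Fin m) ℂ, Tᴴ * T = 1 ∧ T * Tᴴ = 1 ∧ ∀ g, τ g * T = T * σ g := by
  let T : Matrix (Fin n) (Fin m) ℂ := LinearMap.toMatrix' φ.toLinearMap
  have hT : ∀ g, τ g * T = T * σ g := by
    intro g
    have h := φ.isIntertwining' g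
    have h' := congrArg LinearMap.toMatrix' h
    rw [LinearMap.toMatrix'_comp, LinearMap.toMatrix'_comp, toMatrix'_matRep,
      toMatrix'_matRep] at h'
    exact h'.symm
  have hTapp : ∀ v, T *ᵥ v = φ.toLinearMap v := by
    intro v
    rw [← Matrix.toLin'_apply, Matrix.toLin'_toMatrix']
  obtain ⟨c, hc⟩ := exists_eq_smul_one_of_intertwines (matRep σ) hirr (Tᴴ * T) (by
    intro g
    rw [toMatrix'_matRep]
    have hσ' : σ g * (σ g)ᴴ = 1 := mul_eq_one_comm.1 (hσ g)
    have h2 : σ g * Tᴴ = Tᴴ * τ g := by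
      have h3 := congrArg Matrix.conjTranspose (hT g)
      simp only [Matrix.conjTranspose_mul] at h3
      calc σ g * Tᴴ = σ g * (Tᴴ * (τ g)ᴴ) * τ g := by
            rw [Matrix.mul_assoc, Matrix.mul_assoc, hτ, Matrix.mul_one]
        _ = Tᴴ * τ g := by rw [h3, ← Matrix.mul_assoc, hσ', Matrix.one_mul]
    rw [← Matrix.mul_assoc, h2, Matrix.mul_assoc, hT, Matrix.mul_assoc])
  have hm : 0 < m := dim_pos_of_isIrreducible _ hirr
  have hcpsd : 0 ≤ c := by
    have := (Matrix.posSemidef_conjTranspose_mul_self T).diag_nonneg (i := ⟨0, hm⟩)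
    rw [hc] at this
    simpa using this
  have hc0 : c ≠ 0 := by
    rintro rfl
    rw [zero_smul] at hc
    have hT0 : T = 0 := Matrix.conjTranspose_mul_self_eq_zero.1 hc
    have h1 : φ.toLinearMap (fun _ => 1) = 0 := by rw [← hTapp, hT0, Matrix.zero_mulVec]
    have h2 : (fun _ => 1 : Fin m → ℂ) = 0 := by
      have h3 : φ.symm (φ (fun _ => 1 : Fin m → ℂ)) = 0 :=
        (congrArg φ.symm h1).trans (map_zero φ.symm.toLinearMap)
      rwa [Representation.Equiv.symm_apply_apply] at h3
    exact one_ne_zero (congrFun h2 ⟨0, hm⟩)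
  obtain ⟨hre, him⟩ := Complex.nonneg_iff.1 hcpsd
  have hcr : c = (c.re : ℂ) := Complex.ext (by simp) (by simp [← him])
  have hrpos : 0 < c.re := lt_of_le_of_ne hre fun h => hc0 (by rw [hcr, ← h]; simp)
  -- The factor `c^{-1/2}` turns `Tᴴ T = c` into `1`.
  let s : ℂ := ((Real.sqrt c.re)⁻¹ : ℝ)
  have hs : star s * s * c = 1 := by
    have h1 : star s = s := Complex.conj_ofReal _
    rw [h1, hcr]
    simp only [s]
    rw [← Complex.ofReal_mul, ← Complex.ofReal_mul, ← mul_inv, Real.mul_self_sqrt hre,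
      inv_mul_cancel₀ hrpos.ne', Complex.ofReal_one]
  have h1 : (s • T)ᴴ * (s • T) = 1 := by
    rw [Matrix.conjTranspose_smul, Matrix.smul_mul, Matrix.mul_smul, hc, smul_smul, smul_smul,
      hs, one_smul]
  have hcard : m = n := by
    have := φ.toLinearEquiv.finrank_eq
    simpa using this
  refine ⟨s • T, h1, (Matrix.mul_eq_one_comm_of_card_eq _ _ _ (by simp [hcard])).1 h1, fun g => ?_⟩
  rw [Matrix.mul_smul, Matrix.smul_mul, hT]

end Reps

/-! ### Tensor products of operators -/

lemma tensorOp_apply {d n : ℕ} (A : Fin n → Matrix (Fin d) (Fin d) ℂ) (i j : Idx d n) :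
    tensorOp A i j = ∏ l, A l (i l) (j l) := rfl

lemma tensorOp_mul {d n : ℕ} (A B : Fin n → Matrix (Fin d) (Fin d) ℂ) :
    tensorOp A * tensorOp B = tensorOp fun l => A l * B l := by
  ext i j
  simp only [Matrix.mul_apply, tensorOp_apply, ← Finset.prod_mul_distrib]
  exact (Fintype.prod_sum fun l x => A l (i l) x * B l x (j l)).symm

lemma tensorOp_one {d n : ℕ} :
    tensorOp (fun _ : Fin n => (1 : Matrix (Fin d) (Fin d) ℂ)) = 1 := by
  ext i j
  rw [tensorOp_apply, Matrix.one_apply]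
  simp only [Matrix.one_apply]
  rw [Fintype.prod_ite_zero]
  simp [funext_iff]

lemma tensorOp_conjTranspose {d n : ℕ} (A : Fin n → Matrix (Fin d) (Fin d) ℂ) :
    (tensorOp A)ᴴ = tensorOp fun l => (A l)ᴴ := by
  ext i j
  simp [tensorOp_apply, Matrix.conjTranspose_apply]

lemma tensorOp_conjTranspose_mul_self {d n : ℕ} (A : Fin n → Matrix (Fin d) (Fin d) ℂ)
    (hA : ∀ l, (A l)ᴴ * A l = 1) : (tensorOp A)ᴴ * tensorOp A = 1 := by
  rw [tensorOp_conjTranspose, tensorOp_mul]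
  simp only [hA, tensorOp_one]

lemma unitary_conjTranspose_mul {d : ℕ} (U : UGroup d) :
    (U : Matrix (Fin d) (Fin d) ℂ)ᴴ * (U : Matrix (Fin d) (Fin d) ℂ) = 1 :=
  Unitary.coe_star_mul_self U

lemma unitary_mul_conjTranspose {d : ℕ} (U : UGroup d) :
    (U : Matrix (Fin d) (Fin d) ℂ) * (U : Matrix (Fin d) (Fin d) ℂ)ᴴ = 1 :=
  Unitary.coe_mul_star_self U

section Schur

variable {d t : ℕ} {O : Matrix (Fin d) (Fin d) ℂ}

lemma groupedRep_one : groupedRep t (1 : SymGroup O) = 1 := by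
  rw [← tensorOp_one]
  unfold groupedRep
  congr 1
  funext l
  simp

lemma groupedRep_mul (g h : SymGroup O) :
    groupedRep t (g * h) = groupedRep t g * groupedRep t h := by
  unfold groupedRep
  rw [tensorOp_mul]
  congr 1
  funext l
  split_ifs <;> simp

lemma groupedRep_conjTranspose_mul_self (g : SymGroup O) :
    (groupedRep t g)ᴴ * groupedRep t g = 1 := by
  apply tensorOp_conjTranspose_mul_self
  intro l
  split_ifs <;> exact unitary_conjTranspose_mul _

/-! ### Existence of a Schur basis -/

variable (d t O) in
/-- The irreducible summands of `U^{⊗ t+1} ⊗ V^{⊗ t} ⊗ W` are sorted by equivalence classes. In every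
class a representative is chosen, and the orthonormal basis of each member is the image of the basis
of the representative under a unitary intertwiner. -/
theorem nonempty_schurBasis : Nonempty (SchurBasis d t O) := by
  classical
  let e₀ : Fin (Fintype.card (Idx d (2 * t + 2))) ≃ Idx d (2 * t + 2) :=
    (Fintype.equivFin _).symm
  let ρ : SymGroup O →* Matrix (Fin (Fintype.card (Idx d (2 * t + 2))))
      (Fin (Fintype.card (Idx d (2 * t + 2)))) ℂ :=
    { toFun := fun g => (groupedRep t g).submatrix e₀ e₀
      map_one' := by rw [groupedRep_one, Matrix.submatrix_one_equiv]
      map_mul' := fun g h => by rw [groupedRep_mul, Matrix.submatrix_mul_equiv] }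
  have hρ' : ∀ g, ρ g = (groupedRep t g).submatrix e₀ e₀ := fun _ => rfl
  have hρ : ∀ g, (ρ g)ᴴ * ρ g = 1 := by
    intro g
    rw [hρ', Matrix.conjTranspose_submatrix, Matrix.submatrix_mul_equiv,
      groupedRep_conjTranspose_mul_self, Matrix.submatrix_one_equiv]
  obtain ⟨ι, _, n, σ, J, hirr, hiso, horth, hsum, hint⟩ := exists_irreducible_decomposition _ ρ hρ
  have hσ : ∀ i g, (σ i g)ᴴ * σ i g = 1 := by
    intro i g
    have h1 : σ i g = (J i)ᴴ * (ρ g * J i) := by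
      rw [hint, ← Matrix.mul_assoc, hiso, Matrix.one_mul]
    calc (σ i g)ᴴ * σ i g = (J i * σ i g)ᴴ * (J i * σ i g) := by
          rw [Matrix.conjTranspose_mul, Matrix.mul_assoc, ← Matrix.mul_assoc (J i)ᴴ, hiso,
            Matrix.one_mul]
      _ = (J i)ᴴ * ((ρ g)ᴴ * ρ g) * J i := by
          rw [← hint, Matrix.conjTranspose_mul]; simp only [Matrix.mul_assoc]
      _ = 1 := by rw [hρ, Matrix.mul_one, hiso]
  let s : Setoid ι :=
    { r := fun i j => Nonempty ((matRep (σ i)).Equiv (matRep (σ j)))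
      iseqv := ⟨fun i => ⟨.refl _⟩, fun ⟨φ⟩ => ⟨φ.symm⟩, fun ⟨φ⟩ ⟨ψ⟩ => ⟨φ.trans ψ⟩⟩ }
  let e : Fin (Fintype.card (Quotient s)) ≃ Quotient s := (Fintype.equivFin _).symm
  let rep : Fin (Fintype.card (Quotient s)) → ι := fun r => (e r).out
  have hrep : ∀ r, (Quotient.mk s (rep r)) = e r := fun r => Quotient.out_eq _
  let mult : Fin (Fintype.card (Quotient s)) → ℕ := fun r =>
    Fintype.card {i : ι // Quotient.mk s i = e r}
  let f : ∀ r, Fin (mult r) ≃ {i : ι // Quotient.mk s i = e r} := fun r =>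
    (Fintype.equivFin _).symm
  have hT : ∀ r (α : Fin (mult r)), ∃ T : Matrix (Fin (n (f r α).1)) (Fin (n (rep r))) ℂ,
      Tᴴ * T = 1 ∧ T * Tᴴ = 1 ∧ ∀ g, σ (f r α).1 g * T = T * σ (rep r) g := by
    intro r α
    have h : s.r (rep r) (f r α).1 := Quotient.exact ((hrep r).trans (f r α).2.symm)
    exact exists_unitary_intertwiner _ _ (hσ _) (hσ _) (hirr _) h.some
  choose T hT1 hT2 hT3 using hT
  -- `K r α` embeds the representative of the class `r` as the `α`-th member of that class.
  let K : ∀ r, Fin (mult r) → Matrix (Idx d (2 * t + 2)) (Fin (n (rep r))) ℂ := fun r α =>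
    (J (f r α).1 * T r α).submatrix e₀.symm id
  have hKK : ∀ r α, (K r α)ᴴ * K r α = 1 := by
    intro r α
    change ((J (f r α).1 * T r α).submatrix e₀.symm id)ᴴ *
      (J (f r α).1 * T r α).submatrix e₀.symm id = 1
    rw [Matrix.conjTranspose_submatrix, Matrix.submatrix_mul_equiv, Matrix.submatrix_id_id,
      Matrix.conjTranspose_mul, Matrix.mul_assoc, ← Matrix.mul_assoc (J (f r α).1)ᴴ, hiso,
      Matrix.one_mul, hT1]
  have hK0 : ∀ r α r' α', (f r α).1 ≠ (f r' α').1 → (K r α)ᴴ * K r' α' = 0 := by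
    intro r α r' α' hne
    change ((J (f r α).1 * T r α).submatrix e₀.symm id)ᴴ *
      (J (f r' α').1 * T r' α').submatrix e₀.symm id = 0
    rw [Matrix.conjTranspose_submatrix, Matrix.submatrix_mul_equiv, Matrix.submatrix_id_id,
      Matrix.conjTranspose_mul, Matrix.mul_assoc, ← Matrix.mul_assoc (J (f r α).1)ᴴ,
      horth _ _ hne, Matrix.zero_mul, Matrix.mul_zero]
  have hKρ : ∀ r α g, groupedRep t g * K r α = K r α * σ (rep r) g := by
    intro r α g
    have h1 : ρ g * (J (f r α).1 * T r α) = J (f r α).1 * T r α * σ (rep r) g := by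
      rw [← Matrix.mul_assoc, hint, Matrix.mul_assoc, hT3, Matrix.mul_assoc]
    have h2 : groupedRep t g = (ρ g).submatrix e₀.symm e₀.symm := by
      rw [hρ', Matrix.submatrix_submatrix]; simp
    have h3 : σ (rep r) g = (σ (rep r) g).submatrix id id := rfl
    change groupedRep t g * (J (f r α).1 * T r α).submatrix e₀.symm id =
      (J (f r α).1 * T r α).submatrix e₀.symm id * σ (rep r) g
    rw [h2, Matrix.submatrix_mul_equiv, h1, h3]
    exact (Matrix.submatrix_mul _ _ _ _ _ Function.bijective_id)
  have hfne : ∀ r r', r ≠ r' → ∀ α α', (f r α).1 ≠ (f r' α').1 := by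
    intro r r' hne α α' h
    apply hne
    apply e.injective
    rw [← (f r α).2, ← (f r' α').2, h]
  let Q : Matrix (Idx d (2 * t + 2))
      (Σ r : Fin (Fintype.card (Quotient s)), Fin (n (rep r)) × Fin (mult r)) ℂ :=
    Matrix.of fun x q => K q.1 q.2.2 x q.2.1
  have hQ1 : Qᴴ * Q = 1 := by
    ext ⟨r, a, α⟩ ⟨r', b, β⟩
    have h0 : (Qᴴ * Q) ⟨r, a, α⟩ ⟨r', b, β⟩ = ((K r α)ᴴ * K r' β) a b := by
      simp [Matrix.mul_apply, Q]
    rw [h0]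
    by_cases hr : r = r'
    · subst hr
      by_cases hα : α = β
      · subst hα
        rw [hKK]
        simp [Matrix.one_apply]
      · rw [hK0 _ _ _ _ fun h => hα ((f r).injective (Subtype.ext h))]
        simp [hα]
    · rw [hK0 _ _ _ _ (hfne _ _ hr _ _)]
      simp [hr]
  have hQ2 : Q * Qᴴ = 1 := by
    let F : (Σ r, Fin (mult r)) → ι := fun q => (f q.1 q.2).1
    have hF : Function.Bijective F := by
      constructor
      · rintro ⟨r, α⟩ ⟨r', β⟩ h
        by_cases hr : r = r'
        · subst hr
          have : α = β := (f r).injective (Subtype.ext h)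
          rw [this]
        · exact absurd h (hfne _ _ hr _ _)
      · intro i
        refine ⟨⟨e.symm (Quotient.mk s i), (f _).symm ⟨i, (e.apply_symm_apply _).symm⟩⟩, ?_⟩
        simp [F]
    have h1 : ∑ q : Σ r, Fin (mult r), K q.1 q.2 * (K q.1 q.2)ᴴ = 1 := by
      have h2 : ∀ q : Σ r, Fin (mult r), K q.1 q.2 * (K q.1 q.2)ᴴ =
          (J (F q) * (J (F q))ᴴ).submatrix e₀.symm e₀.symm := by
        rintro ⟨r, α⟩
        change (J (f r α).1 * T r α).submatrix e₀.symm id *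
          ((J (f r α).1 * T r α).submatrix e₀.symm id)ᴴ = _
        rw [Matrix.conjTranspose_submatrix,
          ← Matrix.submatrix_mul _ _ _ _ _ Function.bijective_id, Matrix.conjTranspose_mul,
          Matrix.mul_assoc, ← Matrix.mul_assoc (T r α), hT2, Matrix.one_mul]
      rw [Finset.sum_congr rfl fun q _ => h2 q,
        hF.sum_comp fun i => (J i * (J i)ᴴ).submatrix e₀.symm e₀.symm]
      have h3 := congrArg (fun M => Matrix.submatrix M e₀.symm e₀.symm) hsum
      simp only [Matrix.submatrix_one_equiv] at h3
      rw [← h3]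
      ext x y
      simp [Matrix.sum_apply]
    rw [← h1]
    ext x y
    simp only [Matrix.mul_apply, Matrix.sum_apply, Fintype.sum_sigma, Fintype.sum_prod_type, Q,
      Matrix.conjTranspose_apply, Matrix.of_apply]
    exact Finset.sum_congr rfl fun r _ => Finset.sum_comm
  refine ⟨{ numIrr := Fintype.card (Quotient s), dim := fun r => n (rep r), mult := mult,
            mult_pos := fun r => Fintype.card_pos_iff.2 ⟨⟨rep r, hrep r⟩⟩,
            irr := fun r => matRep (σ (rep r)), irreducible := fun r => hirr _,
            inequivalent := fun r r' hne => ⟨fun φ => hne ?_⟩,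
            Q := Q, conjTranspose_mul := hQ1, mul_conjTranspose := hQ2,
            blockDiagonal := fun g => ?_ }⟩
  · apply e.injective
    rw [← hrep r, ← hrep r']
    exact Quotient.sound (s := s) ⟨φ⟩
  · ext ⟨r, a, α⟩ ⟨r', b, β⟩
    have h0 : (Qᴴ * groupedRep t g * Q) ⟨r, a, α⟩ ⟨r', b, β⟩ =
        ((K r α)ᴴ * K r' β * σ (rep r') g) a b := by
      rw [Matrix.mul_assoc, Matrix.mul_assoc, ← hKρ]
      simp [Matrix.mul_apply, Q]
    rw [h0]
    by_cases hr : r = r'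
    · subst hr
      rw [Matrix.blockDiagonal'_apply_eq, toMatrix'_matRep, Matrix.kroneckerMap_apply]
      by_cases hα : α = β
      · subst hα
        rw [hKK]
        simp
      · rw [hK0 _ _ _ _ fun h => hα ((f r).injective (Subtype.ext h))]
        simp [hα]
    · rw [hK0 _ _ _ _ (hfne _ _ hr _ _), Matrix.blockDiagonal'_apply_ne _ _ _ hr]
      simp

end Schur

/-! ### Blocks and symmetric operators -/

/-- The relabelling of multi-indices by a permutation of the systems. -/
def permEquiv {d n : ℕ} (π : Equiv.Perm (Fin n)) : Idx d n ≃ Idx d n where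
  toFun := permIdx π
  invFun := permIdx π.symm
  left_inv i := by funext l; simp [permIdx]
  right_inv i := by funext l; simp [permIdx]

lemma permEquiv_apply {d n : ℕ} (π : Equiv.Perm (Fin n)) (i : Idx d n) :
    permEquiv π i = permIdx π i := rfl

lemma tensorOp_submatrix_permEquiv {d n : ℕ} (π : Equiv.Perm (Fin n))
    (A : Fin n → Matrix (Fin d) (Fin d) ℂ) :
    (tensorOp A).submatrix (permEquiv π) (permEquiv π) = tensorOp fun l => A (π l) := by
  ext i j
  simp only [Matrix.submatrix_apply, tensorOp_apply, permEquiv_apply, permIdx]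
  rw [← Equiv.prod_comp π]
  simp

/-- The operator `U ⊗ (V ⊗ U)^{⊗ t} ⊗ W` in the causal order of the systems. -/
noncomputable def causalRep {d : ℕ} (t : ℕ) {O : Matrix (Fin d) (Fin d) ℂ} (g : SymGroup O) :
    TOp d (2 * t + 2) :=
  tensorOp fun l : Fin (2 * t + 2) =>
      if l = posF t then (g.2.2 : Matrix (Fin d) (Fin d) ℂ)
      else if Even (l : ℕ) then (g.1 : Matrix (Fin d) (Fin d) ℂ)
      else (g.2.1 : Matrix (Fin d) (Fin d) ℂ)

lemma isSymmetric_iff {d t : ℕ} {O : Matrix (Fin d) (Fin d) ℂ} {C : TOp d (2 * t + 2)} :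
    IsSymmetric O C ↔ ∀ g : SymGroup O, Commute C (causalRep t g) :=
  ⟨fun h g => h g.1 g.2.1 g.2.2, fun h U V W => h (U, V, W)⟩

lemma position_cases {t : ℕ} (l : Fin (2 * t + 2)) :
    l = posP t ∨ l = posF t ∨ (∃ k : Fin t, l = posI k) ∨ ∃ k : Fin t, l = posO k := by
  obtain ⟨l, hl⟩ := l
  simp only [posP, posF, posI, posO, Fin.mk.injEq]
  by_cases h0 : l = 0
  · exact Or.inl h0
  by_cases h1 : l = 2 * t + 1
  · exact Or.inr (Or.inl h1)
  rcases Nat.even_or_odd' l with ⟨k, hk | hk⟩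
  · exact Or.inr (Or.inr (Or.inr ⟨⟨k - 1, by omega⟩, by simp only; omega⟩))
  · exact Or.inr (Or.inr (Or.inl ⟨⟨k, by omega⟩, by simp only; omega⟩))

open scoped MatrixOrder Matrix.Norms.L2Operator in
lemma exists_eq_conjTranspose_mul_self {n : Type*} [Fintype n] [DecidableEq n]
    {A : Matrix n n ℂ} (hA : A.PosSemidef) : ∃ B : Matrix n n ℂ, A = Bᴴ * B :=
  CStarAlgebra.nonneg_iff_eq_star_mul_self.1 hA.nonneg

section Blocks

variable {d t : ℕ} {O : Matrix (Fin d) (Fin d) ℂ}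

lemma causalRep_eq_submatrix {π : Equiv.Perm (Fin (2 * t + 2))} (hπ : IsGrouping t π)
    (g : SymGroup O) :
    causalRep t g = (groupedRep t g).submatrix (permEquiv π) (permEquiv π) := by
  unfold groupedRep causalRep
  rw [tensorOp_submatrix_permEquiv]
  congr 1
  funext l
  rcases position_cases l with rfl | rfl | ⟨k, rfl⟩ | ⟨k, rfl⟩
  · rw [hπ.map_P, if_neg (by simp [posP, posF]), if_pos (by simp [posP]),
      if_pos (by simp [posP])]
  · rw [hπ.map_F, if_pos rfl, if_neg (by simp only [posF]; omega), if_neg (by simp [posF])]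
  · have := hπ.map_I k
    rw [if_neg (by simp only [posI, posF, Fin.mk.injEq]; omega),
      if_neg (by simp [posI]), if_neg (by omega), if_pos (by omega)]
  · have := hπ.map_O k
    rw [if_neg (by simp only [posO, posF, Fin.mk.injEq]; omega),
      if_pos (by simp [posO, Nat.even_add]), if_pos (by omega)]

namespace SchurBasis

variable (S : SchurBasis d t O) (π : Equiv.Perm (Fin (2 * t + 2)))

/-- The operator `⊕_r 1 ⊗ C^(r)` in the coordinates of a Schur basis. -/
noncomputable def blockOp (X : S.Blocks) :
    Matrix (Σ r : Fin S.numIrr, Fin (S.dim r) × Fin (S.mult r))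
      (Σ r : Fin S.numIrr, Fin (S.dim r) × Fin (S.mult r)) ℂ :=
  Matrix.blockDiagonal' fun r => (1 : Matrix (Fin (S.dim r)) (Fin (S.dim r)) ℂ) ⊗ₖ X r

lemma assemble_eq (X : S.Blocks) :
    S.assemble π X = (S.Q * S.blockOp X * S.Qᴴ).submatrix (permEquiv π) (permEquiv π) := by
  ext i j
  simp only [assemble, Matrix.of_apply, Matrix.submatrix_apply, Matrix.mul_apply, permEquiv_apply,
    Fintype.sum_sigma, Fintype.sum_prod_type, Matrix.conjTranspose_apply, Finset.sum_mul, p]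
  refine Finset.sum_congr rfl fun r _ => ?_
  have h1 : ∀ (a : Fin (S.dim r)) (β : Fin (S.mult r)) (r' : Fin S.numIrr) (b : Fin (S.dim r'))
      (α : Fin (S.mult r')), S.Q (permIdx π i) ⟨r', (b, α)⟩ * S.blockOp X ⟨r', (b, α)⟩ ⟨r, (a, β)⟩ *
        star (S.Q (permIdx π j) ⟨r, (a, β)⟩) =
      if h : r' = r then (if h ▸ b = a then X r (h ▸ α) β * S.Q (permIdx π i) ⟨r', (b, α)⟩ *
        star (S.Q (permIdx π j) ⟨r, (a, β)⟩) else 0) else 0 := by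
    intro a β r' b α
    by_cases h : r' = r
    · subst h
      rw [dif_pos rfl, blockOp, Matrix.blockDiagonal'_apply_eq, Matrix.kroneckerMap_apply,
        Matrix.one_apply]
      split_ifs <;> ring
    · rw [dif_neg h, blockOp, Matrix.blockDiagonal'_apply_ne _ _ _ h]
      ring
  simp only [h1]
  have h2 : ∀ (a : Fin (S.dim r)) (β : Fin (S.mult r)),
      (∑ r' : Fin S.numIrr, ∑ b : Fin (S.dim r'), ∑ α : Fin (S.mult r'),
        if h : r' = r then (if h ▸ b = a then X r (h ▸ α) β * S.Q (permIdx π i) ⟨r', (b, α)⟩ *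
          star (S.Q (permIdx π j) ⟨r, (a, β)⟩) else 0) else 0) =
      ∑ α, X r α β * S.Q (permIdx π i) ⟨r, (a, α)⟩ * star (S.Q (permIdx π j) ⟨r, (a, β)⟩) := by
    intro a β
    rw [Finset.sum_eq_single r (fun r' _ h => by simp [h]) (by simp),
      Finset.sum_eq_single a (fun b _ h => by simp [h]) (by simp)]
    simp
  simp only [h2]
  calc _ = ∑ β, ∑ α, ∑ a, X r α β * S.Q (permIdx π i) ⟨r, (a, α)⟩ *
        star (S.Q (permIdx π j) ⟨r, (a, β)⟩) := Finset.sum_comm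
    _ = ∑ β, ∑ a, ∑ α, X r α β * S.Q (permIdx π i) ⟨r, (a, α)⟩ *
        star (S.Q (permIdx π j) ⟨r, (a, β)⟩) :=
      Finset.sum_congr rfl fun β _ => Finset.sum_comm
    _ = _ := Finset.sum_comm

/-- The operator `ρ(g)` in the coordinates of a Schur basis. -/
noncomputable def irrOp (g : SymGroup O) :
    Matrix (Σ r : Fin S.numIrr, Fin (S.dim r) × Fin (S.mult r))
      (Σ r : Fin S.numIrr, Fin (S.dim r) × Fin (S.mult r)) ℂ :=
  Matrix.blockDiagonal' fun r =>
    LinearMap.toMatrix' (S.irr r g) ⊗ₖ (1 : Matrix (Fin (S.mult r)) (Fin (S.mult r)) ℂ)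

lemma commute_blockOp_irrOp (X : S.Blocks) (g : SymGroup O) :
    Commute (S.blockOp X) (S.irrOp g) := by
  unfold blockOp irrOp Commute SemiconjBy
  rw [← Matrix.blockDiagonal'_mul, ← Matrix.blockDiagonal'_mul]
  congr 1
  funext r
  rw [← Matrix.mul_kronecker_mul, ← Matrix.mul_kronecker_mul]
  simp

lemma irrOp_mul_apply (g : SymGroup O)
    (D : Matrix (Σ r : Fin S.numIrr, Fin (S.dim r) × Fin (S.mult r))
      (Σ r : Fin S.numIrr, Fin (S.dim r) × Fin (S.mult r)) ℂ) (r : Fin S.numIrr)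
    (a : Fin (S.dim r)) (α : Fin (S.mult r)) (q) :
    (S.irrOp g * D) ⟨r, (a, α)⟩ q =
      ∑ c, LinearMap.toMatrix' (S.irr r g) a c * D ⟨r, (c, α)⟩ q := by
  rw [Matrix.mul_apply, Fintype.sum_sigma, Finset.sum_eq_single r]
  · rw [Fintype.sum_prod_type]
    refine Finset.sum_congr rfl fun c _ => ?_
    rw [Finset.sum_eq_single α]
    · rw [irrOp, Matrix.blockDiagonal'_apply_eq, Matrix.kroneckerMap_apply, Matrix.one_apply_eq,
        mul_one]
    · intro γ _ hγ
      rw [irrOp, Matrix.blockDiagonal'_apply_eq, Matrix.kroneckerMap_apply,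
        Matrix.one_apply_ne hγ.symm, mul_zero, zero_mul]
    · simp
  · intro r' _ hr
    refine Finset.sum_eq_zero fun x _ => ?_
    rw [irrOp, Matrix.blockDiagonal'_apply_ne _ _ _ hr.symm, zero_mul]
  · simp

lemma mul_irrOp_apply (g : SymGroup O)
    (D : Matrix (Σ r : Fin S.numIrr, Fin (S.dim r) × Fin (S.mult r))
      (Σ r : Fin S.numIrr, Fin (S.dim r) × Fin (S.mult r)) ℂ) (r : Fin S.numIrr)
    (a : Fin (S.dim r)) (α : Fin (S.mult r)) (q) :
    (D * S.irrOp g) q ⟨r, (a, α)⟩ =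
      ∑ c, D q ⟨r, (c, α)⟩ * LinearMap.toMatrix' (S.irr r g) c a := by
  rw [Matrix.mul_apply, Fintype.sum_sigma, Finset.sum_eq_single r]
  · rw [Fintype.sum_prod_type]
    refine Finset.sum_congr rfl fun c _ => ?_
    rw [Finset.sum_eq_single α]
    · rw [irrOp, Matrix.blockDiagonal'_apply_eq, Matrix.kroneckerMap_apply, Matrix.one_apply_eq,
        mul_one]
    · intro γ _ hγ
      rw [irrOp, Matrix.blockDiagonal'_apply_eq, Matrix.kroneckerMap_apply,
        Matrix.one_apply_ne hγ, mul_zero, mul_zero]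
    · simp
  · intro r' _ hr
    refine Finset.sum_eq_zero fun x _ => ?_
    rw [irrOp, Matrix.blockDiagonal'_apply_ne _ _ _ hr, mul_zero]
  · simp

/-- The commutant of `⊕_r ρ^r ⊗ 1` consists of the operators `⊕_r 1 ⊗ C^(r)`. -/
lemma exists_blockOp_of_commute
    (D : Matrix (Σ r : Fin S.numIrr, Fin (S.dim r) × Fin (S.mult r))
      (Σ r : Fin S.numIrr, Fin (S.dim r) × Fin (S.mult r)) ℂ)
    (hD : ∀ g, Commute D (S.irrOp g)) : ∃ X : S.Blocks, D = S.blockOp X := by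
  have hint : ∀ r s α β g, LinearMap.toMatrix' (S.irr r g) *
        (Matrix.of fun a b => D ⟨r, (a, α)⟩ ⟨s, (b, β)⟩) =
      (Matrix.of fun a b => D ⟨r, (a, α)⟩ ⟨s, (b, β)⟩) * LinearMap.toMatrix' (S.irr s g) := by
    intro r s α β g
    ext a b
    rw [Matrix.mul_apply, Matrix.mul_apply]
    simp only [Matrix.of_apply]
    rw [← S.irrOp_mul_apply, ← S.mul_irrOp_apply, (hD g).eq]
  choose c hc using fun r α β =>
    exists_eq_smul_one_of_intertwines (S.irr r) (S.irreducible r) _ (hint r r α β)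
  refine ⟨fun r => Matrix.of fun α β => c r α β, ?_⟩
  ext ⟨r, a, α⟩ ⟨s, b, β⟩
  by_cases hrs : r = s
  · subst hrs
    have := congrFun (congrFun (hc r α β) a) b
    rw [Matrix.of_apply] at this
    rw [this, blockOp, Matrix.blockDiagonal'_apply_eq, Matrix.kroneckerMap_apply,
      Matrix.smul_apply, Matrix.of_apply, smul_eq_mul, mul_comm]
  · have h0 := eq_zero_of_intertwines (S.irr s) (S.irr r) (S.irreducible s) (S.irreducible r)
      (S.inequivalent s r (Ne.symm hrs)) _ (hint r s α β)
    rw [blockOp, Matrix.blockDiagonal'_apply_ne _ _ _ hrs]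
    exact congrFun (congrFun h0 a) b

lemma blockOp_injective : Function.Injective S.blockOp := by
  intro X Y h
  funext r
  have h1 := congrFun (Matrix.blockDiagonal'_injective h) r
  ext α β
  let a : Fin (S.dim r) := ⟨0, dim_pos_of_isIrreducible _ (S.irreducible r)⟩
  simpa using congrFun (congrFun h1 (a, α)) (a, β)

lemma groupedRep_eq (g : SymGroup O) : groupedRep t g = S.Q * S.irrOp g * S.Qᴴ := by
  rw [irrOp, ← S.blockDiagonal]
  calc groupedRep t g = (S.Q * S.Qᴴ) * groupedRep t g * (S.Q * S.Qᴴ) := by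
        rw [S.mul_conjTranspose]; simp
    _ = _ := by simp only [Matrix.mul_assoc]

lemma conj_Q_mul (A B : Matrix (Σ r : Fin S.numIrr, Fin (S.dim r) × Fin (S.mult r))
      (Σ r : Fin S.numIrr, Fin (S.dim r) × Fin (S.mult r)) ℂ) :
    (S.Q * A * S.Qᴴ) * (S.Q * B * S.Qᴴ) = S.Q * (A * B) * S.Qᴴ := by
  calc _ = S.Q * A * (S.Qᴴ * S.Q) * B * S.Qᴴ := by simp only [Matrix.mul_assoc]
    _ = _ := by rw [S.conjTranspose_mul, Matrix.mul_one, Matrix.mul_assoc S.Q]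

lemma conj_Q_injective {A B : Matrix (Σ r : Fin S.numIrr, Fin (S.dim r) × Fin (S.mult r))
      (Σ r : Fin S.numIrr, Fin (S.dim r) × Fin (S.mult r)) ℂ}
    (h : S.Q * A * S.Qᴴ = S.Q * B * S.Qᴴ) : A = B := by
  have key : ∀ A : Matrix (Σ r : Fin S.numIrr, Fin (S.dim r) × Fin (S.mult r))
      (Σ r : Fin S.numIrr, Fin (S.dim r) × Fin (S.mult r)) ℂ,
      S.Qᴴ * (S.Q * A * S.Qᴴ) * S.Q = A := by
    intro A
    calc _ = (S.Qᴴ * S.Q) * A * (S.Qᴴ * S.Q) := by simp only [Matrix.mul_assoc]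
      _ = A := by rw [S.conjTranspose_mul, Matrix.one_mul, Matrix.mul_one]
  rw [← key A, h, key]

variable {π}

lemma bijOn_assemble (hπ : IsGrouping t π) :
    Set.BijOn (S.assemble π) Set.univ {C | IsSymmetric O C} := by
  refine ⟨fun X _ => ?_, fun X _ Y _ h => ?_, fun C hC => ?_⟩
  · change IsSymmetric O _
    rw [isSymmetric_iff]
    intro g
    rw [causalRep_eq_submatrix hπ, assemble_eq, groupedRep_eq S]
    unfold Commute SemiconjBy
    rw [Matrix.submatrix_mul_equiv, Matrix.submatrix_mul_equiv, conj_Q_mul, conj_Q_mul,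
      (S.commute_blockOp_irrOp X g).eq]
  · rw [assemble_eq, assemble_eq] at h
    exact S.blockOp_injective (S.conj_Q_injective
      ((Matrix.reindex (permEquiv π).symm (permEquiv π).symm).injective h))
  · let C' := C.submatrix (permEquiv π).symm (permEquiv π).symm
    have hCC' : C = C'.submatrix (permEquiv π) (permEquiv π) := by
      simp [C', Matrix.submatrix_submatrix]
    have hQC : S.Q * (S.Qᴴ * C' * S.Q) * S.Qᴴ = C' := by
      calc _ = (S.Q * S.Qᴴ) * C' * (S.Q * S.Qᴴ) := by simp only [Matrix.mul_assoc]
        _ = C' := by rw [S.mul_conjTranspose, Matrix.one_mul, Matrix.mul_one]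
    obtain ⟨X, hX⟩ := S.exists_blockOp_of_commute (S.Qᴴ * C' * S.Q) (by
      intro g
      apply S.conj_Q_injective
      rw [← conj_Q_mul, ← conj_Q_mul, hQC, ← groupedRep_eq]
      have h1 := (isSymmetric_iff.1 hC g).eq
      rw [causalRep_eq_submatrix hπ, hCC', Matrix.submatrix_mul_equiv,
        Matrix.submatrix_mul_equiv] at h1
      exact (Matrix.reindex (permEquiv π).symm (permEquiv π).symm).injective h1)
    refine ⟨X, trivial, ?_⟩
    rw [assemble_eq, ← hX, hQC, ← hCC']

variable (π)

lemma posSemidef_assemble_iff (X : S.Blocks) :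
    (S.assemble π X).PosSemidef ↔ ∀ r, (X r).PosSemidef := by
  rw [assemble_eq, Matrix.posSemidef_submatrix_equiv]
  constructor
  · intro h r
    have h1 := h.conjTranspose_mul_mul_same S.Q
    have h2 : S.Qᴴ * (S.Q * S.blockOp X * S.Qᴴ) * S.Q = S.blockOp X := by
      calc _ = (S.Qᴴ * S.Q) * S.blockOp X * (S.Qᴴ * S.Q) := by simp only [Matrix.mul_assoc]
        _ = _ := by rw [S.conjTranspose_mul, Matrix.one_mul, Matrix.mul_one]
    rw [h2] at h1
    let a : Fin (S.dim r) := ⟨0, dim_pos_of_isIrreducible _ (S.irreducible r)⟩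
    have h3 := h1.submatrix fun α : Fin (S.mult r) =>
      (⟨r, (a, α)⟩ : Σ r : Fin S.numIrr, Fin (S.dim r) × Fin (S.mult r))
    convert h3 using 1
    ext α β
    simp [blockOp, Matrix.blockDiagonal'_apply_eq]
  · intro h
    apply Matrix.PosSemidef.mul_mul_conjTranspose_same
    choose Y hY using fun r => exists_eq_conjTranspose_mul_self (h r)
    have h1 : S.blockOp X = (S.blockOp Y)ᴴ * S.blockOp Y := by
      unfold blockOp
      rw [Matrix.blockDiagonal'_conjTranspose, ← Matrix.blockDiagonal'_mul]
      congr 1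
      funext r
      rw [Matrix.conjTranspose_kronecker, ← Matrix.mul_kronecker_mul, ← hY]
      simp
    rw [h1]
    exact Matrix.posSemidef_conjTranspose_mul_self _

lemma trace_assemble (X : S.Blocks) :
    (S.assemble π X).trace = ∑ r, (S.dim r : ℂ) * (X r).trace := by
  have h0 : (S.assemble π X).trace = (S.Q * S.blockOp X * S.Qᴴ).trace := by
    rw [assemble_eq]
    exact Equiv.sum_comp (permEquiv π) fun i => (S.Q * S.blockOp X * S.Qᴴ) i i
  rw [h0, Matrix.trace_mul_comm, ← Matrix.mul_assoc, S.conjTranspose_mul, Matrix.one_mul,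
    blockOp, Matrix.trace_blockDiagonal']
  simp [Matrix.trace_kronecker]

end SchurBasis
end Blocks

/-! ### Partial traces -/

/-- The splitting of a multi-index on `n` systems into its first `m` and its last `n - m` entries. -/
def splitEquiv {d n m : ℕ} (h : m ≤ n) : Idx d n ≃ Idx d m × Idx d (n - m) where
  toFun u := (fun l => u (Fin.castLE h l), fun l => u ⟨m + l, by omega⟩)
  invFun q := glue q.1 q.2
  left_inv u := by
    funext l
    simp only [glue]
    split_ifs with hl
    · rfl
    · congr 1
      ext
      simp only
      omega
  right_inv q := by
    ext l
    · simp [glue]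
    · simp [glue]

/-- The splitting of a multi-index into its first entries and its last one. -/
def initLastEquiv {d m : ℕ} : Idx d (m + 1) ≃ Idx d m × Fin d where
  toFun u := (Fin.init u, u (Fin.last m))
  invFun q := Fin.snoc q.1 q.2
  left_inv u := Fin.snoc_init_self u
  right_inv q := by simp

lemma tensorOp_eq_kronecker {d n m : ℕ} (h : m ≤ n) (A : Fin n → Matrix (Fin d) (Fin d) ℂ) :
    tensorOp A = ((tensorOp fun l : Fin m => A (Fin.castLE h l)) ⊗ₖ
      (tensorOp fun l : Fin (n - m) => A ⟨m + l, by omega⟩)).submatrix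
        (splitEquiv h) (splitEquiv h) := by
  ext u v
  simp only [Matrix.submatrix_apply, Matrix.kroneckerMap_apply, tensorOp_apply, splitEquiv,
    Equiv.coe_fn_mk]
  rw [← Equiv.prod_comp (finSumFinEquiv.trans (finCongr (Nat.add_sub_of_le h))),
    Fintype.prod_sum_type]
  rfl

lemma tensorOp_succ {d m : ℕ} (A : Fin (m + 1) → Matrix (Fin d) (Fin d) ℂ) :
    tensorOp A = ((tensorOp fun l : Fin m => A l.castSucc) ⊗ₖ A (Fin.last m)).submatrix
      initLastEquiv initLastEquiv := by
  ext u v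
  simp only [Matrix.submatrix_apply, Matrix.kroneckerMap_apply, tensorOp_apply]
  exact Fin.prod_univ_castSucc _

lemma tensorLast_eq_kronecker {d m : ℕ} (A : TOp d m) (B : Matrix (Fin d) (Fin d) ℂ) :
    tensorLast A B = (A ⊗ₖ B).submatrix initLastEquiv initLastEquiv := rfl

lemma tailTrace_apply {d n : ℕ} (m : ℕ) (A : TOp d n) (i j : Idx d m) :
    tailTrace m A i j = ∑ z : Idx d (n - m), A (glue i z) (glue j z) := rfl

/-- A partial trace is covariant under local unitaries. -/
lemma tailTrace_conj {d n m : ℕ} (h : m ≤ n) (A : Fin n → Matrix (Fin d) (Fin d) ℂ)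
    (hA : ∀ l, (A l)ᴴ * A l = 1) (C : TOp d n) :
    tailTrace m (tensorOp A * C * (tensorOp A)ᴴ) =
      (tensorOp fun l : Fin m => A (Fin.castLE h l)) * tailTrace m C *
        (tensorOp fun l : Fin m => A (Fin.castLE h l))ᴴ := by
  have hB := tensorOp_conjTranspose_mul_self
    (fun l : Fin (n - m) => A ⟨m + l, by omega⟩) fun l => hA _
  set A₁ := tensorOp fun l : Fin m => A (Fin.castLE h l)
  set B := tensorOp fun l : Fin (n - m) => A ⟨m + l, by omega⟩
  have hAB : ∀ (i k : Idx d m) (z w : Idx d (n - m)),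
      tensorOp A (glue i z) (glue k w) = A₁ i k * B z w := by
    intro i k z w
    rw [tensorOp_eq_kronecker h, Matrix.submatrix_apply]
    change (A₁ ⊗ₖ B) (splitEquiv h ((splitEquiv h).symm (i, z)))
      (splitEquiv h ((splitEquiv h).symm (k, w))) = _
    rw [Equiv.apply_symm_apply, Equiv.apply_symm_apply]
    rfl
  have hsum : ∀ F : Idx d n → ℂ, ∑ u, F u = ∑ k : Idx d m, ∑ w : Idx d (n - m), F (glue k w) := by
    intro F
    rw [← Equiv.sum_comp (splitEquiv h).symm, Fintype.sum_prod_type]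
    rfl
  have hBB : ∀ w w', ∑ z, B z w * star (B z w') = if w' = w then 1 else 0 := by
    intro w w'
    have := congrFun (congrFun hB w') w
    rw [Matrix.mul_apply, Matrix.one_apply] at this
    rw [← this]
    exact Finset.sum_congr rfl fun z _ => mul_comm _ _
  ext i j
  simp only [tailTrace_apply, Matrix.mul_apply, Matrix.conjTranspose_apply, hsum, hAB, star_mul',
    Finset.sum_mul, Finset.mul_sum]
  calc _ = ∑ l, ∑ w', ∑ k, ∑ w, ∑ z, A₁ i k * C (glue k w) (glue l w') * star (A₁ j l) *
        (B z w * star (B z w')) := by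
        rw [Finset.sum_comm]
        refine Finset.sum_congr rfl fun l _ => ?_
        rw [Finset.sum_comm]
        refine Finset.sum_congr rfl fun w' _ => ?_
        rw [Finset.sum_comm]
        refine Finset.sum_congr rfl fun k _ => ?_
        rw [Finset.sum_comm]
        refine Finset.sum_congr rfl fun w _ => Finset.sum_congr rfl fun z _ => ?_
        ring
    _ = ∑ l, ∑ w', ∑ k, A₁ i k * C (glue k w') (glue l w') * star (A₁ j l) := by
        refine Finset.sum_congr rfl fun l _ => Finset.sum_congr rfl fun w' _ =>
          Finset.sum_congr rfl fun k _ => ?_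
        simp only [← Finset.mul_sum, hBB, mul_ite, mul_one, mul_zero, Finset.sum_ite_eq,
          Finset.mem_univ, if_true]
    _ = ∑ l, ∑ k, ∑ w', A₁ i k * C (glue k w') (glue l w') * star (A₁ j l) :=
        Finset.sum_congr rfl fun l _ => Finset.sum_comm

lemma tensorLast_conj {d m : ℕ} (A : Fin (m + 1) → Matrix (Fin d) (Fin d) ℂ)
    (hA : ∀ l, A l * (A l)ᴴ = 1) (R : TOp d m) (c : ℂ) :
    tensorLast ((tensorOp fun l : Fin m => A l.castSucc) * R *
        (tensorOp fun l : Fin m => A l.castSucc)ᴴ) (c • 1) =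
      tensorOp A * tensorLast R (c • 1) * (tensorOp A)ᴴ := by
  rw [tensorOp_succ A, tensorLast_eq_kronecker, tensorLast_eq_kronecker,
    Matrix.conjTranspose_submatrix, Matrix.submatrix_mul_equiv, Matrix.submatrix_mul_equiv,
    Matrix.conjTranspose_kronecker, ← Matrix.mul_kronecker_mul, ← Matrix.mul_kronecker_mul]
  simp [hA]

/-- The partial trace over the last `n - m` systems is the one over the last `n - m - 1` systems,
followed by the trace over one further system. -/
lemma tailTrace_eq_sum {d n m : ℕ} (h : m + 1 ≤ n) (C : TOp d n) (i j : Idx d m) :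
    tailTrace m C i j = ∑ x : Fin d,
      tailTrace (m + 1) C (Fin.snoc i x : Idx d (m + 1)) (Fin.snoc j x : Idx d (m + 1)) := by
  let φ : Idx d (n - m) → Fin d × Idx d (n - (m + 1)) := fun z =>
    (z ⟨0, by omega⟩, fun l => z ⟨l + 1, by omega⟩)
  have hφ : Function.Bijective φ := by
    rw [Fintype.bijective_iff_injective_and_card]
    refine ⟨fun z w hzw => ?_, ?_⟩
    · have h0 := congrArg Prod.fst hzw
      have h1 := congrArg Prod.snd hzw
      funext l
      rcases Nat.eq_zero_or_pos (l : ℕ) with hl | hl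
      · have : l = ⟨0, by omega⟩ := Fin.ext hl
        rw [this]
        exact h0
      · have h2 := congrFun h1 ⟨l - 1, by omega⟩
        have : l = ⟨(l - 1 : ℕ) + 1, by omega⟩ := Fin.ext (by simp only; omega)
        rw [this]
        exact h2
    · simp only [Fintype.card_prod, Fintype.card_pi, Fintype.card_fin, Finset.prod_const,
        Finset.card_univ]
      rw [← pow_succ']
      congr 1
      omega
  have hglue : ∀ (i : Idx d m) (z : Idx d (n - m)),
      glue i z = (glue (Fin.snoc i (φ z).1 : Idx d (m + 1)) (φ z).2 : Idx d n) := by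
    intro i z
    funext l
    simp only [glue, φ]
    by_cases h1 : (l : ℕ) < m
    · rw [dif_pos h1, dif_pos (by omega)]
      simp [Fin.snoc, h1]
    · rw [dif_neg h1]
      by_cases h2 : (l : ℕ) < m + 1
      · rw [dif_pos h2]
        simp only [Fin.snoc, h1, dif_neg, not_false_eq_true, cast_eq]
        congr 1
        ext
        simp only
        omega
      · rw [dif_neg h2]
        congr 1
        ext
        simp only
        omega
  simp only [tailTrace_apply]
  rw [← Fintype.sum_prod_type', ← hφ.sum_comp]
  exact Finset.sum_congr rfl fun z _ => by rw [hglue i z, hglue j z]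

/-- The operator `R ⊗ 1` on `n` systems. -/
noncomputable def padOp {d n m : ℕ} (h : m ≤ n) (R : TOp d m) : TOp d n :=
  (R ⊗ₖ (1 : TOp d (n - m))).submatrix (splitEquiv h) (splitEquiv h)

lemma commute_padOp {d n m : ℕ} (h : m ≤ n) (A : Fin n → Matrix (Fin d) (Fin d) ℂ) (R : TOp d m)
    (hR : Commute R (tensorOp fun l : Fin m => A (Fin.castLE h l))) :
    Commute (padOp h R) (tensorOp A) := by
  unfold Commute SemiconjBy padOp
  rw [tensorOp_eq_kronecker h, Matrix.submatrix_mul_equiv, Matrix.submatrix_mul_equiv,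
    ← Matrix.mul_kronecker_mul, ← Matrix.mul_kronecker_mul, hR.eq, Matrix.one_mul, Matrix.mul_one]

lemma tailTrace_padOp {d n m : ℕ} (h : m + 1 ≤ n) (R : TOp d m) (i j : Idx d m) (x : Fin d) :
    tailTrace (m + 1) (padOp (by omega : m ≤ n) R) (Fin.snoc i x : Idx d (m + 1))
      (Fin.snoc j x : Idx d (m + 1)) = (d : ℂ) ^ (n - (m + 1)) * R i j := by
  have h1 : ∀ z : Idx d (n - (m + 1)),
      padOp (by omega : m ≤ n) R (glue (Fin.snoc i x : Idx d (m + 1)) z)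
        (glue (Fin.snoc j x : Idx d (m + 1)) z) = R i j := by
    intro z
    have hfst : ∀ i : Idx d m, (splitEquiv (by omega : m ≤ n)
        (glue (Fin.snoc i x : Idx d (m + 1)) z)).1 = i := by
      intro i
      funext l
      have hl := l.2
      simp only [splitEquiv, Equiv.coe_fn_mk, glue, Fin.val_castLE]
      rw [dif_pos (by omega)]
      simp [Fin.snoc]
    have hsnd : (splitEquiv (by omega : m ≤ n) (glue (Fin.snoc i x : Idx d (m + 1)) z)).2 =
        (splitEquiv (by omega : m ≤ n) (glue (Fin.snoc j x : Idx d (m + 1)) z)).2 := by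
      funext l
      simp [splitEquiv, glue, Fin.snoc]
    rw [padOp, Matrix.submatrix_apply, Matrix.kroneckerMap_apply, hfst, hfst, hsnd,
      Matrix.one_apply_eq, mul_one]
  rw [tailTrace_apply, Finset.sum_congr rfl fun z _ => h1 z]
  simp

/-! ### The constraints -/

section Constraints

variable {d t : ℕ} {O : Matrix (Fin d) (Fin d) ℂ}

/-- The tensor factors of `U ⊗ (V ⊗ U)^{⊗ t} ⊗ W`. -/
def causalFactor (t : ℕ) {d : ℕ} {O : Matrix (Fin d) (Fin d) ℂ} (g : SymGroup O)
    (l : Fin (2 * t + 2)) : Matrix (Fin d) (Fin d) ℂ :=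
  if l = posF t then g.2.2 else if Even (l : ℕ) then g.1 else g.2.1

lemma causalRep_eq_tensorOp (g : SymGroup O) : causalRep t g = tensorOp (causalFactor t g) := rfl

lemma causalFactor_conjTranspose_mul (g : SymGroup O) (l : Fin (2 * t + 2)) :
    (causalFactor t g l)ᴴ * causalFactor t g l = 1 := by
  unfold causalFactor
  split_ifs <;> exact unitary_conjTranspose_mul _

lemma causalFactor_mul_conjTranspose (g : SymGroup O) (l : Fin (2 * t + 2)) :
    causalFactor t g l * (causalFactor t g l)ᴴ = 1 :=
  mul_eq_one_comm.1 (causalFactor_conjTranspose_mul g l)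

lemma causalRep_conjTranspose_mul (g : SymGroup O) :
    (causalRep t g)ᴴ * causalRep t g = 1 :=
  tensorOp_conjTranspose_mul_self _ (causalFactor_conjTranspose_mul g)

lemma causalRep_mul_conjTranspose (g : SymGroup O) :
    causalRep t g * (causalRep t g)ᴴ = 1 :=
  mul_eq_one_comm.1 (causalRep_conjTranspose_mul g)

lemma commute_iff_conj_eq {C : TOp d (2 * t + 2)} (g : SymGroup O) :
    Commute C (causalRep t g) ↔ causalRep t g * C * (causalRep t g)ᴴ = C := by
  constructor
  · intro h
    rw [← h.eq, Matrix.mul_assoc, causalRep_mul_conjTranspose, Matrix.mul_one]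
  · intro h
    unfold Commute SemiconjBy
    nth_rewrite 1 [← h]
    rw [Matrix.mul_assoc, causalRep_conjTranspose_mul, Matrix.mul_one]

/-- If `C` is symmetric, so is `Tr_K C ⊗ 1`. -/
lemma isSymmetric_padOp_tailTrace {C : TOp d (2 * t + 2)} (hC : IsSymmetric O C) {m : ℕ}
    (h : m ≤ 2 * t + 2) : IsSymmetric O (padOp h (tailTrace m C)) := by
  rw [isSymmetric_iff] at hC ⊢
  intro g
  refine commute_padOp h (causalFactor t g) _ ?_
  have h1 := tailTrace_conj h (causalFactor t g) (causalFactor_conjTranspose_mul g) C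
  rw [← causalRep_eq_tensorOp, (commute_iff_conj_eq g).1 (hC g)] at h1
  have h2 := tensorOp_conjTranspose_mul_self (fun l : Fin m => causalFactor t g (Fin.castLE h l))
    fun l => causalFactor_conjTranspose_mul g _
  unfold Commute SemiconjBy
  nth_rewrite 1 [h1]
  rw [Matrix.mul_assoc, h2, Matrix.mul_one]

namespace SchurBasis

variable (S : SchurBasis d t O) (π : Equiv.Perm (Fin (2 * t + 2)))

lemma assemble_apply (X : S.Blocks) (i j : Idx d (2 * t + 2)) :
    S.assemble π X i j = ∑ r, ∑ α, ∑ β, ∑ a,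
      X r α β * S.p r a α (permIdx π i) * star (S.p r a β (permIdx π j)) := rfl

/-- The left sides of the reduced constraints are the entries of the partial traces of `C`. -/
lemma sum_trace_mul_MK (X : S.Blocks) (m : ℕ) (i j : Idx d m) (x y : Fin d) :
    ∑ r, (X r * S.MK π r m (i, x) (j, y)).trace =
      tailTrace (m + 1) (S.assemble π X) (Fin.snoc i x : Idx d (m + 1))
        (Fin.snoc j y : Idx d (m + 1)) := by
  classical
  simp only [tailTrace_apply, assemble_apply]
  rw [Finset.sum_comm]
  refine Finset.sum_congr rfl fun r _ => ?_
  have hMK : ∀ α β, S.MK π r m (i, x) (j, y) β α = ∑ q : Fin (S.dim r) × Idx d _,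
      S.p r q.1 α (permIdx π (glue (Fin.snoc i x : Idx d (m + 1)) q.2)) *
        star (S.p r q.1 β (permIdx π (glue (Fin.snoc j y : Idx d (m + 1)) q.2))) := by
    intro α β
    unfold MK
    rw [Matrix.of_apply]
    -- Outside the two supports the summand vanishes, so the sum may be extended to all pairs.
    refine Finset.sum_subset (Finset.subset_univ _) fun q _ hq => ?_
    by_contra hne
    apply hq
    rw [Finset.mem_inter, supp, supp, Finset.mem_filter, Finset.mem_filter]
    exact ⟨⟨Finset.mem_univ _, α, left_ne_zero_of_mul hne⟩,
      ⟨Finset.mem_univ _, β, fun h0 => right_ne_zero_of_mul hne (by rw [h0, star_zero])⟩⟩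
  simp only [Matrix.trace, Matrix.diag_apply, Matrix.mul_apply, hMK, Finset.mul_sum,
    Fintype.sum_prod_type]
  calc _ = ∑ α, ∑ β, ∑ z : Idx d (2 * t + 2 - (m + 1)), ∑ a, X r α β *
        (S.p r a α (permIdx π (glue (Fin.snoc i x : Idx d (m + 1)) z)) *
          star (S.p r a β (permIdx π (glue (Fin.snoc j y : Idx d (m + 1)) z)))) :=
        Finset.sum_congr rfl fun α _ => Finset.sum_congr rfl fun β _ => Finset.sum_comm
    _ = ∑ α, ∑ z : Idx d (2 * t + 2 - (m + 1)), ∑ β, ∑ a, X r α β *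
        (S.p r a α (permIdx π (glue (Fin.snoc i x : Idx d (m + 1)) z)) *
          star (S.p r a β (permIdx π (glue (Fin.snoc j y : Idx d (m + 1)) z)))) :=
        Finset.sum_congr rfl fun α _ => Finset.sum_comm
    _ = _ := by
        rw [Finset.sum_comm]
        simp only [mul_assoc]

lemma MK_eq_zero {m : ℕ} {q q' : Idx d m × Fin d} (h : (q, q') ∉ S.pairSet π m)
    (r : Fin S.numIrr) : S.MK π r m q q' = 0 := by
  classical
  have hempty : S.supp π r m q ∩ S.supp π r m q' = ∅ := by
    by_contra hne
    obtain ⟨w, hw⟩ := Finset.nonempty_iff_ne_empty.2 hne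
    apply h
    refine Set.mem_iUnion.2 ⟨r, ⟨⟨w, (Finset.mem_inter.1 hw).1⟩, ⟨w, (Finset.mem_inter.1 hw).2⟩⟩, ?_⟩
    refine ⟨w, ?_⟩
    convert hw
  ext β α
  unfold MK
  rw [Matrix.of_apply, Matrix.zero_apply]
  refine Finset.sum_eq_zero fun w hw => ?_
  exfalso
  have hw' : w ∈ S.supp π r m q ∩ S.supp π r m q' := by convert hw
  rw [hempty] at hw'
  simp at hw'

variable {π}

/-- A diagonal pair `((i, x), (j, x))` lies outside `S_K^π` only if the entry at `(i, j)` of the next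
partial trace vanishes on all symmetric operators: the entry of `Tr_K C ⊗ 1` at the pair is a
positive multiple of it. -/
lemma tailTrace_eq_zero_of_notMem_pairSet (hd : 0 < d) (hπ : IsGrouping t π) (X : S.Blocks) {m : ℕ}
    (hm : m + 1 ≤ 2 * t + 2) (i j : Idx d m) (x : Fin d)
    (h : ((i, x), (j, x)) ∉ S.pairSet π m) : tailTrace m (S.assemble π X) i j = 0 := by
  have hsymm : IsSymmetric O (S.assemble π X) := (S.bijOn_assemble hπ).mapsTo (Set.mem_univ X)
  obtain ⟨Y, -, hY⟩ := (S.bijOn_assemble hπ).surjOn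
    (isSymmetric_padOp_tailTrace hsymm (by omega : m ≤ 2 * t + 2))
  have h1 := S.sum_trace_mul_MK π Y m i j x x
  rw [hY, tailTrace_padOp hm] at h1
  simp only [S.MK_eq_zero π h, Matrix.mul_zero, Matrix.trace_zero, Finset.sum_const_zero] at h1
  have hd' : (d : ℂ) ^ (2 * t + 2 - (m + 1)) ≠ 0 := pow_ne_zero _ (Nat.cast_ne_zero.2 hd.ne')
  exact (mul_eq_zero.1 h1.symm).resolve_left hd'

/-- The linear constraints of both programs agree under the correspondence of `X` and `C`. -/
lemma isReducedFeasible_iff (hd : 0 < d) (hπ : IsGrouping t π) (X : S.Blocks) :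
    S.IsReducedFeasible π X ↔ IsFeasible (S.assemble π X) := by
  have hR : ∀ s, s ≤ t → ∀ i j : Idx d (2 * s),
      ∑ z : Fin d, ∑ r, (X r * S.MK π r (2 * s) (i, z) (j, z)).trace =
        tailTrace (2 * s) (S.assemble π X) i j := by
    intro s hs i j
    rw [tailTrace_eq_sum (by omega)]
    exact Finset.sum_congr rfl fun z _ => S.sum_trace_mul_MK π X _ i j z z
  have hcomb : ∀ s, s ≤ t → (tailTrace (2 * s + 1) (S.assemble π X) =
      tensorLast (tailTrace (2 * s) (S.assemble π X))
        ((1 / (d : ℂ)) • (1 : Matrix (Fin d) (Fin d) ℂ)) ↔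
      ∀ (i j : Idx d (2 * s)) (x y : Fin d),
        ∑ r, (X r * S.MK π r (2 * s) (i, x) (j, y)).trace =
        (if x = y then 1 else 0) / (d : ℂ) *
          ∑ z : Fin d, ∑ r, (X r * S.MK π r (2 * s) (i, z) (j, z)).trace) := by
    intro s hs
    have hent : ∀ (i j : Idx d (2 * s)) (x y : Fin d),
        tensorLast (tailTrace (2 * s) (S.assemble π X))
          ((1 / (d : ℂ)) • (1 : Matrix (Fin d) (Fin d) ℂ)) (Fin.snoc i x : Idx d (2 * s + 1))
            (Fin.snoc j y : Idx d (2 * s + 1)) =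
        (if x = y then 1 else 0) / (d : ℂ) * tailTrace (2 * s) (S.assemble π X) i j := by
      intro i j x y
      simp only [tensorLast, Matrix.of_apply, Fin.init_snoc, Fin.snoc_last, Matrix.smul_apply,
        Matrix.one_apply, smul_eq_mul]
      ring
    constructor
    · intro h i j x y
      rw [S.sum_trace_mul_MK, hR s hs, ← hent, h]
    · intro h
      ext u v
      have := h (Fin.init u) (Fin.init v) (u (Fin.last _)) (v (Fin.last _))
      rwa [S.sum_trace_mul_MK, hR s hs, ← hent, Fin.snoc_init_self, Fin.snoc_init_self] at this
  constructor
  · intro h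
    refine ⟨(S.posSemidef_assemble_iff π X).2 h.posSemidef, fun s hs => ?_, ?_⟩
    · refine (hcomb s hs).2 fun i j x y => ?_
      by_cases hp : ((i, x), (j, y)) ∈ S.pairSet π (2 * s)
      · exact h.comb s hs i j x y hp
      · simp only [S.MK_eq_zero π hp, Matrix.mul_zero, Matrix.trace_zero, Finset.sum_const_zero]
        -- Off `S_K^π` the left side vanishes; the right side does for `x ≠ y` by its Kronecker delta.
        by_cases hxy : x = y
        · subst hxy
          rw [hR s hs, S.tailTrace_eq_zero_of_notMem_pairSet hd hπ X (by omega) i j x hp, mul_zero]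
        · rw [if_neg hxy, zero_div, zero_mul]
    · rw [S.trace_assemble]
      exact h.trace_eq
  · intro h
    exact ⟨(S.posSemidef_assemble_iff π X).1 h.posSemidef,
      fun s hs i j x y _ => (hcomb s hs).1 (h.comb s hs) i j x y,
      by rw [← S.trace_assemble π X]; exact h.trace_eq⟩

end SchurBasis
end Constraints

/-! ### The target function -/

section Objective

variable {d t : ℕ}

/-- The product over the slots of the matrix elements `⟨e_{O_k}| U |e_{I_k}⟩`. -/
def slotAmp (t : ℕ) (U : Matrix (Fin d) (Fin d) ℂ) (i : Idx d (2 * t + 2)) : ℂ :=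
  ∏ k : Fin t, U (i (posO k)) (i (posI k))

/-- The part of `deviation O C U` that is linear in `C`, entry by entry. -/
noncomputable def combOutput (O : Matrix (Fin d) (Fin d) ℂ) (C : TOp d (2 * t + 2))
    (U : Matrix (Fin d) (Fin d) ℂ) : Matrix (Fin d) (Fin d) ℂ :=
  Matrix.of fun p q => ∑ i : Idx d (2 * t + 2), ∑ j : Idx d (2 * t + 2),
    if i (posP t) = q ∧ j (posP t) = p then
      C i j * (slotAmp t U i * star (slotAmp t U j)) * O (j (posF t)) (i (posF t)) else 0

lemma posI_ne_posP (k : Fin t) : posI k ≠ posP t := by simp [posI, posP]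

lemma posO_ne_posP (k : Fin t) : posO k ≠ posP t := by simp [posO, posP]

lemma posI_ne_posF (k : Fin t) : posI k ≠ posF t := by
  simp only [posI, posF, ne_eq, Fin.mk.injEq]; omega

lemma posO_ne_posF (k : Fin t) : posO k ≠ posF t := by
  simp only [posO, posF, ne_eq, Fin.mk.injEq]; omega

lemma causalIdx_posP (p : Fin d) (w : Idx d (2 * t)) (f : Fin d) :
    causalIdx p w f (posP t) = p := by simp [causalIdx, posP]

lemma causalIdx_posF (p : Fin d) (w : Idx d (2 * t)) (f : Fin d) :
    causalIdx p w f (posF t) = f := by simp [causalIdx, posF]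

lemma causalIdx_of_ne (p p' : Fin d) (w : Idx d (2 * t)) (f f' : Fin d) (l : Fin (2 * t + 2))
    (h : l ≠ posP t) (h' : l ≠ posF t) : causalIdx p w f l = causalIdx p' w f' l := by
  have h0 : (l : ℕ) ≠ 0 := fun e => h (Fin.ext e)
  have h1 : (l : ℕ) ≠ 2 * t + 1 := fun e => h' (Fin.ext e)
  have h2 : (l : ℕ) < 2 * t + 1 := by omega
  simp [causalIdx, h0, h2]

lemma sum_causalIdx (F : Idx d (2 * t + 2) → ℂ) :
    ∑ i, F i = ∑ p, ∑ f, ∑ w, F (causalIdx p w f) := by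
  let φ : (Fin d × Fin d) × Idx d (2 * t) → Idx d (2 * t + 2) := fun x =>
    causalIdx x.1.1 x.2 x.1.2
  have hφ : Function.Bijective φ := by
    rw [Fintype.bijective_iff_injective_and_card]
    refine ⟨?_, ?_⟩
    · rintro ⟨⟨p, f⟩, w⟩ ⟨⟨p', f'⟩, w'⟩ h
      have hp := congrFun h (posP t)
      have hf := congrFun h (posF t)
      simp only [φ, causalIdx_posP] at hp
      simp only [φ, causalIdx_posF] at hf
      have hw : w = w' := by
        funext l
        have := congrFun h ⟨l + 1, by omega⟩
        simpa [φ, causalIdx] using this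
      rw [hp, hf, hw]
    · simp only [Fintype.card_prod, Fintype.card_pi, Fintype.card_fin, Finset.prod_const,
        Finset.card_univ]
      ring
  rw [← hφ.sum_comp, Fintype.sum_prod_type, Fintype.sum_prod_type]

lemma choiVec_apply (U : Matrix (Fin d) (Fin d) ℂ) (a b : Fin d) : choiVec U (a, b) = U b a := by
  simp [choiVec, Matrix.mulVec, dotProduct, Fintype.sum_prod_type, Matrix.one_apply]

lemma choiOp_apply (U : Matrix (Fin d) (Fin d) ℂ) (x y : Fin d × Fin d) :
    choiOp U x y = U x.2 x.1 * star (U y.2 y.1) := by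
  obtain ⟨a, b⟩ := x
  obtain ⟨a', b'⟩ := y
  simp only [choiOp, Matrix.vecMulVec_apply, Pi.star_apply, choiVec_apply]

lemma linkU_apply (C : TOp d (2 * t + 2)) (U : Matrix (Fin d) (Fin d) ℂ) (q g p f : Fin d) :
    linkU C U (q, g) (p, f) = ∑ w, ∑ w', C (causalIdx q w g) (causalIdx p w' f) *
      (slotAmp t U (causalIdx q w g) * star (slotAmp t U (causalIdx p w' f))) := by
  have hslots : ∀ (a b : Fin d) (w w' : Idx d (2 * t)),
      slotsOp t U (causalIdx a w b) (causalIdx p w' f) = if a = p then (if b = f then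
        slotAmp t U (causalIdx q w g) * star (slotAmp t U (causalIdx p w' f)) else 0) else 0 := by
    intro a b w w'
    have h1 : slotAmp t U (causalIdx a w b) = slotAmp t U (causalIdx q w g) :=
      Finset.prod_congr rfl fun k _ => by
        rw [causalIdx_of_ne a q w b g _ (posO_ne_posP k) (posO_ne_posF k),
          causalIdx_of_ne a q w b g _ (posI_ne_posP k) (posI_ne_posF k)]
    simp only [slotsOp, Matrix.of_apply, causalIdx_posP, causalIdx_posF, Matrix.one_apply,
      choiOp_apply, Finset.prod_mul_distrib]
    rw [← h1]
    split_ifs <;> simp [slotAmp]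
  have htr : ∀ w w' : Idx d (2 * t), transposeIO C (causalIdx q w' g) (causalIdx p w f) =
      C (causalIdx q w g) (causalIdx p w' f) := by
    intro w w'
    simp only [transposeIO, Matrix.of_apply]
    congr 1
    · funext l
      split_ifs with h
      · rcases h with rfl | rfl
        · simp only [causalIdx_posP]
        · simp only [causalIdx_posF]
      · push Not at h
        exact causalIdx_of_ne _ _ _ _ _ _ h.1 h.2
    · funext l
      split_ifs with h
      · rcases h with rfl | rfl
        · simp only [causalIdx_posP]
        · simp only [causalIdx_posF]
      · push Not at h
        exact causalIdx_of_ne _ _ _ _ _ _ h.1 h.2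
  simp only [linkU, traceIO, Matrix.of_apply, Matrix.mul_apply]
  rw [Finset.sum_comm]
  simp only [sum_causalIdx, hslots, mul_ite, mul_zero]
  rw [Finset.sum_eq_single p (fun a _ h => by simp [h]) (by simp),
    Finset.sum_eq_single f (fun b _ h => by simp [h]) (by simp)]
  simp only [if_true, htr]

lemma combOutput_apply (O : Matrix (Fin d) (Fin d) ℂ) (C : TOp d (2 * t + 2))
    (U : Matrix (Fin d) (Fin d) ℂ) (p q : Fin d) :
    combOutput O C U p q = ∑ f, ∑ g, linkU C U (q, g) (p, f) * O f g := by
  simp only [combOutput, Matrix.of_apply]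
  simp only [sum_causalIdx, causalIdx_posP, causalIdx_posF, linkU_apply, Finset.sum_mul]
  rw [Finset.sum_eq_single q (fun a _ h => by simp [h]) (by simp)]
  calc _ = ∑ g, ∑ w, ∑ f, ∑ w', C (causalIdx q w g) (causalIdx p w' f) *
        (slotAmp t U (causalIdx q w g) * star (slotAmp t U (causalIdx p w' f))) * O f g := by
        refine Finset.sum_congr rfl fun g _ => Finset.sum_congr rfl fun w _ => ?_
        rw [Finset.sum_eq_single p (fun a _ h => by simp [h]) (by simp)]
        simp
    _ = ∑ g, ∑ f, ∑ w, ∑ w', C (causalIdx q w g) (causalIdx p w' f) *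
        (slotAmp t U (causalIdx q w g) * star (slotAmp t U (causalIdx p w' f))) * O f g :=
        Finset.sum_congr rfl fun g _ => Finset.sum_comm
    _ = _ := Finset.sum_comm

lemma switchOp_mul_mul_switchOp_apply (A : Matrix (Fin d × Fin d) (Fin d × Fin d) ℂ)
    (x y : Fin d × Fin d) : (switchOp d * A * switchOp d) x y = A x.swap y.swap := by
  have h1 : ∀ z, (switchOp d * A) x z = A x.swap z := by
    intro z
    rw [Matrix.mul_apply, Finset.sum_eq_single x.swap]
    · simp [switchOp]
    · intro b _ hb
      have : x ≠ b.swap := fun h => hb (by rw [h, Prod.swap_swap])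
      simp [switchOp, this]
    · simp
  rw [Matrix.mul_apply, Finset.sum_eq_single y.swap]
  · rw [h1]
    simp [switchOp]
  · intro b _ hb
    simp [switchOp, hb]
  · simp

lemma deviation_eq (O : Matrix (Fin d) (Fin d) ℂ) (C : TOp d (2 * t + 2))
    (U : Matrix (Fin d) (Fin d) ℂ) :
    deviation O C U = combOutput O C U - U * O * Uᴴ := by
  have hkron : ∀ (A : Matrix (Fin d × Fin d) (Fin d × Fin d) ℂ) (f p q : Fin d),
      (A * (O.transpose ⊗ₖ (1 : Matrix (Fin d) (Fin d) ℂ))) (f, p) (f, q) =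
        ∑ g, A (f, p) (g, q) * O f g := by
    intro A f p q
    rw [Matrix.mul_apply, Fintype.sum_prod_type]
    refine Finset.sum_congr rfl fun g _ => ?_
    rw [Finset.sum_eq_single q]
    · simp
    · intro b _ hb
      simp [Matrix.one_apply_ne hb]
    · simp
  ext p q
  rw [Matrix.sub_apply, combOutput_apply]
  simp only [deviation, traceFst, Matrix.of_apply, Matrix.sub_apply, Finset.sum_sub_distrib, hkron,
    switchOp_mul_mul_switchOp_apply, Matrix.transpose_apply, Prod.swap_prod_mk, choiOp_apply]
  congr 1
  rw [Matrix.mul_apply]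
  simp only [Matrix.mul_apply, Matrix.conjTranspose_apply, Finset.sum_mul]
  rw [Finset.sum_comm]
  exact Finset.sum_congr rfl fun g _ => Finset.sum_congr rfl fun f _ => by ring

lemma sum_cons (F : Idx d (2 * t + 2) → ℂ) :
    ∑ i, F i = ∑ x : Fin d, ∑ v : Idx d (2 * t + 1), F (Fin.cons x v : Idx d (2 * t + 2)) := by
  rw [← Equiv.sum_comp (Fin.consEquiv fun _ => Fin d), Fintype.sum_prod_type]
  rfl

namespace SchurBasis

variable {O : Matrix (Fin d) (Fin d) ℂ} (S : SchurBasis d t O) (π : Equiv.Perm (Fin (2 * t + 2)))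

lemma MU_apply (U : Matrix (Fin d) (Fin d) ℂ) (r : Fin S.numIrr) (j₁ i₁ : Fin d)
    (α β : Fin (S.mult r)) :
    S.MU π U r j₁ i₁ β α = ∑ a, ∑ i : Idx d (2 * t + 2), ∑ j : Idx d (2 * t + 2),
      if i (posP t) = i₁ ∧ j (posP t) = j₁ then
        S.p r a α (permIdx π i) * star (S.p r a β (permIdx π j)) *
          (slotAmp t U i * star (slotAmp t U j)) * O (j (posF t)) (i (posF t)) else 0 := by
  classical
  have hcons : ∀ (x : Fin d) (v : Idx d (2 * t + 1)),
      (Fin.cons x v : Idx d (2 * t + 2)) (posP t) = x := fun x v => rfl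
  have htrace : ∀ x y : Fin d,
      (Matrix.single x y (1 : ℂ) * O.transpose).trace = O x y := by
    intro x y
    rw [Matrix.trace_single_mul]
    simp
  unfold MU
  rw [Matrix.of_apply]
  refine Finset.sum_congr rfl fun a _ => ?_
  simp only [sum_cons, hcons]
  rw [Finset.sum_eq_single i₁ (fun b _ h => by simp [h]) (by simp)]
  refine Finset.sum_subset_zero_on_sdiff (Finset.subset_univ _) (fun v hv => ?_) (fun v hv => ?_)
  · have h0 : S.p r a α (permIdx π (Fin.cons i₁ v : Idx d (2 * t + 2))) = 0 := by
      by_contra hne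
      exact (Finset.mem_sdiff.1 hv).2 (Finset.mem_filter.2 ⟨Finset.mem_univ _, hne⟩)
    simp [h0]
  · rw [Finset.sum_eq_single j₁ (fun b _ h => by simp [h]) (by simp)]
    refine Finset.sum_subset_zero_on_sdiff (Finset.subset_univ _) (fun w hw => ?_) (fun w hw => ?_)
    · have h0 : S.p r a β (permIdx π (Fin.cons j₁ w : Idx d (2 * t + 2))) = 0 := by
        by_contra hne
        exact (Finset.mem_sdiff.1 hw).2 (Finset.mem_filter.2 ⟨Finset.mem_univ _, hne⟩)
      simp [h0]
    · simp only [and_self, if_true, htrace, slotAmp, star_prod, Finset.prod_mul_distrib]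

/-- The linear part of the reduced target function is that of the original one. -/
lemma sum_trace_mul_MU (X : S.Blocks) (U : Matrix (Fin d) (Fin d) ℂ) (j₁ i₁ : Fin d) :
    ∑ r, (X r * S.MU π U r j₁ i₁).trace = combOutput O (S.assemble π X) U j₁ i₁ := by
  simp only [Matrix.trace, Matrix.diag_apply, Matrix.mul_apply, MU_apply, combOutput,
    Matrix.of_apply, assemble_apply]
  have hpull : ∀ (i j : Idx d (2 * t + 2)),
      (if i (posP t) = i₁ ∧ j (posP t) = j₁ then
        (∑ r, ∑ α, ∑ β, ∑ a, X r α β * S.p r a α (permIdx π i) * star (S.p r a β (permIdx π j))) *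
          (slotAmp t U i * star (slotAmp t U j)) * O (j (posF t)) (i (posF t)) else 0) =
      ∑ r, ∑ α, ∑ β, ∑ a, if i (posP t) = i₁ ∧ j (posP t) = j₁ then
        X r α β * (S.p r a α (permIdx π i) * star (S.p r a β (permIdx π j)) *
          (slotAmp t U i * star (slotAmp t U j)) * O (j (posF t)) (i (posF t))) else 0 := by
    intro i j
    split_ifs
    · simp only [Finset.sum_mul]
      refine Finset.sum_congr rfl fun r _ => Finset.sum_congr rfl fun α _ =>
        Finset.sum_congr rfl fun β _ => Finset.sum_congr rfl fun a _ => ?_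
      ring
    · simp
  simp only [hpull, Finset.mul_sum, mul_ite, mul_zero]
  have hswap : ∀ {κ : Type} [Fintype κ] (F : κ → Idx d (2 * t + 2) → Idx d (2 * t + 2) → ℂ),
      ∑ k, ∑ i, ∑ j, F k i j = ∑ i, ∑ j, ∑ k, F k i j := by
    intro κ _ F
    rw [Finset.sum_comm]
    exact Finset.sum_congr rfl fun i _ => Finset.sum_comm
  simp only [hswap]

/-- The two target functions agree, already at every single unitary `U`. -/
lemma reducedObjective_eq (X : S.Blocks) :
    S.reducedObjective π X = objective O (S.assemble π X) := by
  unfold reducedObjective objective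
  congr 1
  funext U
  rw [deviation_eq]
  congr 2
  ext p q
  rw [← S.sum_trace_mul_MU π]
  simp only [Matrix.sum_apply, Matrix.smul_apply, Matrix.single_apply, smul_eq_mul, mul_ite,
    mul_one, mul_zero]
  refine Finset.sum_congr rfl fun r _ => ?_
  rw [Finset.sum_eq_single q (fun b _ h => by simp [h]) (by simp),
    Finset.sum_eq_single p (fun b _ h => by simp [h]) (by simp)]
  simp

end SchurBasis

/-! ### Covariance of the target function -/

/-- Multi-indices by their entries on `P`, on the slots and on `F`. -/
lemma bijective_slotEntries : Function.Bijective fun i : Idx d (2 * t + 2) =>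
    ((i (posP t), i (posF t)), fun k : Fin t => (i (posI k), i (posO k))) := by
  rw [Fintype.bijective_iff_injective_and_card]
  refine ⟨fun i j h => ?_, ?_⟩
  · simp only [Prod.mk.injEq] at h
    funext l
    rcases position_cases l with rfl | rfl | ⟨k, rfl⟩ | ⟨k, rfl⟩
    · exact h.1.1
    · exact h.1.2
    · exact congrArg Prod.fst (congrFun h.2 k)
    · exact congrArg Prod.snd (congrFun h.2 k)
  · simp only [Fintype.card_prod, Fintype.card_pi, Fintype.card_fin, Finset.prod_const,
      Finset.card_univ]
    ring

lemma sum_slotEntries (F : Fin d → (Fin t → Fin d × Fin d) → Fin d → ℂ) :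
    ∑ i : Idx d (2 * t + 2), F (i (posP t)) (fun k => (i (posI k), i (posO k))) (i (posF t)) =
      ∑ p, ∑ f, ∑ x, F p x f := by
  rw [bijective_slotEntries.sum_comp fun y : (Fin d × Fin d) × (Fin t → Fin d × Fin d) =>
    F y.1.1 y.2 y.1.2, Fintype.sum_prod_type, Fintype.sum_prod_type]

lemma prod_positions (F : Fin (2 * t + 2) → ℂ) :
    ∏ l, F l = F (posP t) * (∏ k : Fin t, F (posI k) * F (posO k)) * F (posF t) := by
  let φ : (Unit ⊕ Unit) ⊕ (Fin t ⊕ Fin t) → Fin (2 * t + 2) :=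
    Sum.elim (Sum.elim (fun _ => posP t) (fun _ => posF t)) (Sum.elim posI posO)
  have hφ : Function.Bijective φ := by
    rw [Fintype.bijective_iff_surjective_and_card]
    refine ⟨fun l => ?_, ?_⟩
    · rcases position_cases l with rfl | rfl | ⟨k, rfl⟩ | ⟨k, rfl⟩
      exacts [⟨.inl (.inl ()), rfl⟩, ⟨.inl (.inr ()), rfl⟩, ⟨.inr (.inl k), rfl⟩,
        ⟨.inr (.inr k), rfl⟩]
    · simp only [Fintype.card_sum, Fintype.card_unit, Fintype.card_fin]
      ring
  rw [← hφ.prod_comp, Fintype.prod_sum_type, Fintype.prod_sum_type, Fintype.prod_sum_type,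
    Finset.prod_mul_distrib]
  simp only [φ, Sum.elim_inl, Sum.elim_inr, Finset.univ_unique, Finset.prod_singleton]
  ring

variable {O : Matrix (Fin d) (Fin d) ℂ}

lemma causalRep_apply (g : SymGroup O) (i j : Idx d (2 * t + 2)) :
    causalRep t g i j = (g.1 : Matrix (Fin d) (Fin d) ℂ) (i (posP t)) (j (posP t)) *
      (∏ k : Fin t, (g.2.1 : Matrix (Fin d) (Fin d) ℂ) (i (posI k)) (j (posI k)) *
        (g.1 : Matrix (Fin d) (Fin d) ℂ) (i (posO k)) (j (posO k))) *
      (g.2.2 : Matrix (Fin d) (Fin d) ℂ) (i (posF t)) (j (posF t)) := by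
  have hP : causalFactor t g (posP t) = g.1 := by
    rw [causalFactor, if_neg (by simp [posP, posF]), if_pos (by simp [posP])]
  have hF : causalFactor t g (posF t) = g.2.2 := by
    rw [causalFactor, if_pos rfl]
  have hI : ∀ k : Fin t, causalFactor t g (posI k) = g.2.1 := fun k => by
    rw [causalFactor, if_neg (posI_ne_posF k), if_neg (by simp [posI])]
  have hO : ∀ k : Fin t, causalFactor t g (posO k) = g.1 := fun k => by
    rw [causalFactor, if_neg (posO_ne_posF k), if_pos (by simp [posO, Nat.even_add])]
  rw [causalRep_eq_tensorOp, tensorOp_apply, prod_positions]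
  simp only [hP, hF, hI, hO]

/-- Contraction of the local unitary `U₀ ⊗ (V ⊗ U₀)^{⊗ t} ⊗ W` with the slot amplitudes of `U`: in
the slots `U` becomes `U₀ᵀ U V`. -/
lemma sum_slotAmp_mul_causalRep (g : SymGroup O) (U : Matrix (Fin d) (Fin d) ℂ) (q : Fin d)
    (M : Fin d → ℂ) (k : Idx d (2 * t + 2)) :
    ∑ i, (if i (posP t) = q then slotAmp t U i * M (i (posF t)) * causalRep t g i k else 0) =
      (g.1 : Matrix (Fin d) (Fin d) ℂ) q (k (posP t)) *
        slotAmp t ((g.1 : Matrix (Fin d) (Fin d) ℂ)ᵀ * U * (g.2.1 : Matrix (Fin d) (Fin d) ℂ)) k *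
        ∑ b, M b * (g.2.2 : Matrix (Fin d) (Fin d) ℂ) b (k (posF t)) := by
  simp only [causalRep_apply, slotAmp]
  rw [sum_slotEntries fun p x f => if p = q then (∏ l, U (x l).2 (x l).1) * M f *
    ((g.1 : Matrix (Fin d) (Fin d) ℂ) p (k (posP t)) *
      (∏ l : Fin t, (g.2.1 : Matrix (Fin d) (Fin d) ℂ) (x l).1 (k (posI l)) *
        (g.1 : Matrix (Fin d) (Fin d) ℂ) (x l).2 (k (posO l))) *
      (g.2.2 : Matrix (Fin d) (Fin d) ℂ) f (k (posF t))) else 0]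
  rw [Finset.sum_eq_single q (fun b _ h => by simp [h]) (by simp)]
  simp only [if_true]
  have hslot : ∏ l : Fin t, ((g.1 : Matrix (Fin d) (Fin d) ℂ)ᵀ * U *
        (g.2.1 : Matrix (Fin d) (Fin d) ℂ)) (k (posO l)) (k (posI l)) =
      ∑ x : Fin t → Fin d × Fin d, ∏ l, U (x l).2 (x l).1 *
        ((g.2.1 : Matrix (Fin d) (Fin d) ℂ) (x l).1 (k (posI l)) *
        (g.1 : Matrix (Fin d) (Fin d) ℂ) (x l).2 (k (posO l))) := by
    rw [← Fintype.prod_sum fun (l : Fin t) (y : Fin d × Fin d) => U y.2 y.1 *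
        ((g.2.1 : Matrix (Fin d) (Fin d) ℂ) y.1 (k (posI l)) *
        (g.1 : Matrix (Fin d) (Fin d) ℂ) y.2 (k (posO l)))]
    refine Finset.prod_congr rfl fun l _ => ?_
    rw [Matrix.mul_apply, Fintype.sum_prod_type]
    refine Finset.sum_congr rfl fun a _ => ?_
    rw [Matrix.mul_apply, Finset.sum_mul]
    refine Finset.sum_congr rfl fun b _ => ?_
    rw [Matrix.transpose_apply]
    ring
  rw [hslot, Finset.mul_sum]
  refine Finset.sum_congr rfl fun f _ => ?_
  rw [Finset.mul_sum, Finset.sum_mul]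
  refine Finset.sum_congr rfl fun x _ => ?_
  simp only [Finset.prod_mul_distrib]
  ring

lemma sum_comm_pairs {κ ν : Type*} [Fintype κ] [Fintype ν] (F : κ → κ → ν → ν → ℂ) :
    ∑ a, ∑ b, ∑ x, ∑ y, F a b x y = ∑ x, ∑ y, ∑ a, ∑ b, F a b x y := by
  have h := Finset.sum_comm (s := (Finset.univ : Finset (κ × κ)))
    (t := (Finset.univ : Finset (ν × ν))) (f := fun a x => F a.1 a.2 x.1 x.2)
  simpa only [Fintype.sum_prod_type] using h

lemma centralizer_conj (W : centralizerU O) :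
    (W : Matrix (Fin d) (Fin d) ℂ)ᴴ * O * (W : Matrix (Fin d) (Fin d) ℂ) = O := by
  have h : (W : Matrix (Fin d) (Fin d) ℂ) * O = O * (W : Matrix (Fin d) (Fin d) ℂ) := W.2
  rw [Matrix.mul_assoc, ← h, ← Matrix.mul_assoc, unitary_conjTranspose_mul, Matrix.one_mul]

/-- Conjugation of `C` by `U₀ ⊗ (V ⊗ U₀)^{⊗ t} ⊗ W` replaces `U` by `U₀ᵀ U V` and conjugates the
output by `U₀ᵀ`; on `F` the unitary `W` drops out since it commutes with `O`. -/
lemma combOutput_conj (g : SymGroup O) (C : TOp d (2 * t + 2)) (U : Matrix (Fin d) (Fin d) ℂ) :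
    combOutput O (causalRep t g * C * (causalRep t g)ᴴ) U =
      (g.1 : Matrix (Fin d) (Fin d) ℂ)ᵀᴴ *
        combOutput O C ((g.1 : Matrix (Fin d) (Fin d) ℂ)ᵀ * U * (g.2.1 : Matrix (Fin d) (Fin d) ℂ)) *
        (g.1 : Matrix (Fin d) (Fin d) ℂ)ᵀ := by
  set U' := (g.1 : Matrix (Fin d) (Fin d) ℂ)ᵀ * U * (g.2.1 : Matrix (Fin d) (Fin d) ℂ) with hU'
  have hO := centralizer_conj g.2.2
  set W : Matrix (Fin d) (Fin d) ℂ := (g.2.2 : Matrix (Fin d) (Fin d) ℂ) with hW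
  set U₀ : Matrix (Fin d) (Fin d) ℂ := (g.1 : Matrix (Fin d) (Fin d) ℂ) with hU₀
  ext p q
  have hi : ∀ (j k : Idx d (2 * t + 2)), ∑ i, (if i (posP t) = q then
      slotAmp t U i * O (j (posF t)) (i (posF t)) * causalRep t g i k else 0) =
      U₀ q (k (posP t)) * slotAmp t U' k * (O * W) (j (posF t)) (k (posF t)) := fun j k =>
    sum_slotAmp_mul_causalRep g U q (fun b => O (j (posF t)) b) k
  have hj : ∀ (k l : Idx d (2 * t + 2)), ∑ j, (if j (posP t) = p then
      star (slotAmp t U j) * (O * W) (j (posF t)) (k (posF t)) * star (causalRep t g j l) else 0) =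
      star (U₀ p (l (posP t))) * star (slotAmp t U' l) * O (l (posF t)) (k (posF t)) := by
    intro k l
    have h1 := congrArg star (sum_slotAmp_mul_causalRep g U p
      (fun b => star ((O * W) b (k (posF t)))) l)
    rw [star_sum] at h1
    have h2 : O (l (posF t)) (k (posF t)) =
        ∑ b, star (W b (l (posF t))) * (O * W) b (k (posF t)) := by
      conv_lhs => rw [← hO]
      rw [Matrix.mul_assoc, Matrix.mul_apply]
      rfl
    rw [h2]
    simp only [apply_ite star, star_mul', star_star, star_zero, star_sum] at h1
    rw [h1]
    congr 1
    exact Finset.sum_congr rfl fun b _ => mul_comm _ _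
  have hL : combOutput O (causalRep t g * C * (causalRep t g)ᴴ) U p q =
      ∑ k, ∑ l, C k l * ∑ j, (if j (posP t) = p then star (slotAmp t U j) *
        (∑ i, (if i (posP t) = q then
          slotAmp t U i * O (j (posF t)) (i (posF t)) * causalRep t g i k else 0)) *
          star (causalRep t g j l) else 0) := by
    simp only [combOutput, Matrix.of_apply, Matrix.mul_apply, Matrix.conjTranspose_apply]
    have e1 : ∀ i j : Idx d (2 * t + 2), (if i (posP t) = q ∧ j (posP t) = p then
        (∑ l, (∑ k, causalRep t g i k * C k l) * star (causalRep t g j l)) *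
          (slotAmp t U i * star (slotAmp t U j)) * O (j (posF t)) (i (posF t)) else 0) =
        ∑ k, ∑ l, if j (posP t) = p then (if i (posP t) = q then C k l * (star (slotAmp t U j) *
          (slotAmp t U i * O (j (posF t)) (i (posF t)) * causalRep t g i k) *
            star (causalRep t g j l)) else 0) else 0 := by
      intro i j
      by_cases h1 : i (posP t) = q <;> by_cases h2 : j (posP t) = p
      · simp only [h1, h2, and_self, if_true, Finset.sum_mul]
        rw [Finset.sum_comm]
        refine Finset.sum_congr rfl fun k _ => Finset.sum_congr rfl fun l _ => ?_
        ring
      · simp [h2]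
      · simp [h1]
      · simp [h1]
    have e2 : ∀ k l : Idx d (2 * t + 2), C k l * ∑ j, (if j (posP t) = p then
        star (slotAmp t U j) * (∑ i, (if i (posP t) = q then
          slotAmp t U i * O (j (posF t)) (i (posF t)) * causalRep t g i k else 0)) *
          star (causalRep t g j l) else 0) =
        ∑ i, ∑ j, if j (posP t) = p then (if i (posP t) = q then C k l * (star (slotAmp t U j) *
          (slotAmp t U i * O (j (posF t)) (i (posF t)) * causalRep t g i k) *
            star (causalRep t g j l)) else 0) else 0 := by
      intro k l
      rw [Finset.mul_sum, Finset.sum_comm]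
      refine Finset.sum_congr rfl fun j _ => ?_
      split_ifs with h
      · simp only [Finset.mul_sum, Finset.sum_mul, mul_ite, ite_mul, mul_zero, zero_mul]
      · simp
    simp only [e1, e2]
    exact sum_comm_pairs _
  have hj' : ∀ k l : Idx d (2 * t + 2), ∑ j, (if j (posP t) = p then star (slotAmp t U j) *
        (U₀ q (k (posP t)) * slotAmp t U' k * (O * W) (j (posF t)) (k (posF t))) *
          star (causalRep t g j l) else 0) = (U₀ q (k (posP t)) * slotAmp t U' k) *
        (star (U₀ p (l (posP t))) * star (slotAmp t U' l) * O (l (posF t)) (k (posF t))) := by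
    intro k l
    rw [← hj k l, Finset.mul_sum]
    refine Finset.sum_congr rfl fun j _ => ?_
    split_ifs
    · ring
    · simp
  rw [hL]
  simp only [hi, hj']
  simp only [Matrix.mul_apply, combOutput, Matrix.of_apply, Matrix.conjTranspose_apply,
    Matrix.transpose_apply, Finset.mul_sum, Finset.sum_mul, mul_ite, ite_mul, mul_zero, zero_mul]
  symm
  calc _ = ∑ k : Idx d (2 * t + 2), ∑ l : Idx d (2 * t + 2), ∑ b, ∑ a,
        if k (posP t) = b ∧ l (posP t) = a then star (U₀ p a) *
          (C k l * (slotAmp t U' k * star (slotAmp t U' l)) * O (l (posF t)) (k (posF t))) *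
            U₀ q b else 0 := by
        exact sum_comm_pairs _
    _ = _ := by
        refine Finset.sum_congr rfl fun k _ => Finset.sum_congr rfl fun l _ => ?_
        rw [Finset.sum_eq_single (k (posP t)) (fun b _ h => by simp [h.symm]) (by simp),
          Finset.sum_eq_single (l (posP t)) (fun b _ h => by simp [h.symm]) (by simp)]
        simp only [and_self, if_true]
        ring

end Objective

/-! ### The Frobenius norm -/

/-- The square of the Frobenius norm. -/
noncomputable def sqNorm {n : Type*} [Fintype n] (A : Matrix n n ℂ) : ℝ := ∑ i, ∑ j, ‖A i j‖ ^ 2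

lemma sqNorm_eq_trace {n : Type*} [Fintype n] (A : Matrix n n ℂ) :
    (sqNorm A : ℂ) = (Aᴴ * A).trace := by
  simp only [sqNorm, Matrix.trace, Matrix.diag_apply, Matrix.mul_apply,
    Matrix.conjTranspose_apply, Complex.ofReal_sum]
  rw [Finset.sum_comm]
  refine Finset.sum_congr rfl fun j _ => Finset.sum_congr rfl fun i _ => ?_
  rw [Complex.ofReal_pow, ← Complex.conj_mul']
  rfl

lemma sqNorm_mul_mul {n : Type*} [Fintype n] [DecidableEq n] (A B C : Matrix n n ℂ)
    (hA : Aᴴ * A = 1) (hC : C * Cᴴ = 1) : sqNorm (A * B * C) = sqNorm B := by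
  rw [← Complex.ofReal_inj, sqNorm_eq_trace, sqNorm_eq_trace]
  calc ((A * B * C)ᴴ * (A * B * C)).trace = (Cᴴ * (Bᴴ * (Aᴴ * A) * B * C)).trace := by
        simp only [Matrix.conjTranspose_mul, Matrix.mul_assoc]
    _ = (Bᴴ * B).trace := by
        rw [hA, Matrix.mul_one, Matrix.trace_mul_comm, Matrix.mul_assoc, hC, Matrix.mul_one]

lemma continuous_sqNorm {n : Type*} [Fintype n] :
    Continuous (sqNorm : Matrix n n ℂ → ℝ) := by
  unfold sqNorm
  fun_prop

/-- Strict convexity of the squared norm, in the form used here: if neither end point of a segment is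
longer than the midpoint, the end points coincide. -/
lemma eq_of_sqNorm_le_midpoint {n : Type*} [Fintype n] {A B : Matrix n n ℂ}
    (hA : sqNorm A ≤ sqNorm ((1 / 2 : ℂ) • (A + B)))
    (hB : sqNorm B ≤ sqNorm ((1 / 2 : ℂ) • (A + B))) : A = B := by
  have hpar : sqNorm ((1 / 2 : ℂ) • (A + B)) =
      (sqNorm A + sqNorm B) / 2 - (∑ i, ∑ j, ‖A i j - B i j‖ ^ 2) / 4 := by
    simp only [sqNorm, Matrix.smul_apply, Matrix.add_apply, smul_eq_mul, norm_mul, mul_pow]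
    rw [← Finset.sum_add_distrib, Finset.sum_div, Finset.sum_div, ← Finset.sum_sub_distrib]
    refine Finset.sum_congr rfl fun i _ => ?_
    rw [← Finset.sum_add_distrib, Finset.sum_div, Finset.sum_div, ← Finset.sum_sub_distrib]
    refine Finset.sum_congr rfl fun j _ => ?_
    have h := parallelogram_law_with_norm ℝ (A i j) (B i j)
    have h2 : ‖(1 / 2 : ℂ)‖ = 1 / 2 := by norm_num
    rw [h2]
    linarith
  have hle : ∑ i, ∑ j, ‖A i j - B i j‖ ^ 2 ≤ 0 := by linarith
  have hnn : ∀ i, 0 ≤ ∑ j, ‖A i j - B i j‖ ^ 2 := fun i => Finset.sum_nonneg fun j _ => sq_nonneg _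
  have h0 := (Finset.sum_eq_zero_iff_of_nonneg fun i _ => hnn i).1
    (le_antisymm hle (Finset.sum_nonneg fun i _ => hnn i))
  ext i j
  have h1 := (Finset.sum_eq_zero_iff_of_nonneg fun j _ => sq_nonneg _).1
    (h0 i (Finset.mem_univ _)) j (Finset.mem_univ _)
  exact sub_eq_zero.1 (norm_eq_zero.1 (pow_eq_zero_iff two_ne_zero |>.1 h1))

section Frobenius

attribute [local instance] Matrix.frobeniusNormedAddCommGroup Matrix.frobeniusNormedSpace

variable {d : ℕ}

lemma frobNorm_eq_sqrt (A : Matrix (Fin d) (Fin d) ℂ) : frobNorm A = Real.sqrt (sqNorm A) := by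
  have h : frobNorm A = (∑ i, ∑ j, ‖A i j‖ ^ (2 : ℝ)) ^ (1 / 2 : ℝ) := Matrix.frobenius_norm_def A
  rw [h, Real.sqrt_eq_rpow, sqNorm]
  simp only [Real.rpow_two]

lemma frobNorm_half_add_le (A B : Matrix (Fin d) (Fin d) ℂ) :
    frobNorm ((1 / 2 : ℂ) • (A + B)) ≤ (frobNorm A + frobNorm B) / 2 := by
  have h : ‖(1 / 2 : ℂ) • (A + B)‖ ≤ (‖A‖ + ‖B‖) / 2 := by
    rw [norm_smul]
    have h2 : ‖(1 / 2 : ℂ)‖ = 1 / 2 := by norm_num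
    rw [h2]
    linarith [norm_add_le A B]
  exact h

end Frobenius

section Minimum

variable {d t : ℕ}

lemma continuous_frobNorm : Continuous (frobNorm : Matrix (Fin d) (Fin d) ℂ → ℝ) := by
  have : (frobNorm : Matrix (Fin d) (Fin d) ℂ → ℝ) = fun A => Real.sqrt (sqNorm A) :=
    funext frobNorm_eq_sqrt
  rw [this]
  exact Real.continuous_sqrt.comp continuous_sqNorm

/-! ### Haar measure and the target function -/

instance instIsHaarMeasureHaarU : (haarU d).IsHaarMeasure := by
  unfold haarU; infer_instance

instance instIsProbabilityMeasureHaarU : IsProbabilityMeasure (haarU d) :=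
  ⟨Measure.haarMeasure_self⟩

/-- A compact group is unimodular. -/
instance instIsMulRightInvariantHaarU : (haarU d).IsMulRightInvariant := by
  refine ⟨fun g => ?_⟩
  have : IsProbabilityMeasure (Measure.map (· * g) (haarU d)) :=
    Measure.isProbabilityMeasure_map (by fun_prop)
  exact Measure.isHaarMeasure_eq_of_isProbabilityMeasure _ _

lemma continuous_deviation (O : Matrix (Fin d) (Fin d) ℂ) :
    Continuous fun q : TOp d (2 * t + 2) × UGroup d =>
      deviation O q.1 (q.2 : Matrix (Fin d) (Fin d) ℂ) := by
  have hU : Continuous fun q : TOp d (2 * t + 2) × UGroup d => (q.2 : Matrix (Fin d) (Fin d) ℂ) :=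
    continuous_subtype_val.comp continuous_snd
  have hC : Continuous fun q : TOp d (2 * t + 2) × UGroup d => q.1 := continuous_fst
  have hamp : ∀ i, Continuous fun q : TOp d (2 * t + 2) × UGroup d =>
      slotAmp t (q.2 : Matrix (Fin d) (Fin d) ℂ) i := fun i =>
    continuous_finsetProd _ fun k _ => hU.matrix_elem _ _
  simp only [deviation_eq]
  refine Continuous.sub ?_ ((hU.mul continuous_const).mul hU.matrix_conjTranspose)
  refine continuous_matrix fun p q => ?_
  simp only [combOutput, Matrix.of_apply]
  refine continuous_finsetSum _ fun i _ => continuous_finsetSum _ fun j _ => ?_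
  split_ifs
  · exact ((hC.matrix_elem _ _).mul ((hamp i).mul (hamp j).star)).mul continuous_const
  · exact continuous_const

lemma continuous_deviation_unitary (O : Matrix (Fin d) (Fin d) ℂ) (C : TOp d (2 * t + 2)) :
    Continuous fun U : UGroup d => deviation O C (U : Matrix (Fin d) (Fin d) ℂ) := by
  have h : Continuous fun U : UGroup d => (C, U) := continuous_const.prodMk continuous_id
  have h' := (continuous_deviation O).comp h
  exact h'

lemma integrable_frobNorm_deviation (O : Matrix (Fin d) (Fin d) ℂ) (C : TOp d (2 * t + 2)) :
    Integrable (fun U : UGroup d => frobNorm (deviation O C (U : Matrix (Fin d) (Fin d) ℂ)))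
      (haarU d) :=
  (continuous_frobNorm.comp (continuous_deviation_unitary O C)).integrable_of_hasCompactSupport
    (HasCompactSupport.of_compactSpace _)

lemma continuous_objective (O : Matrix (Fin d) (Fin d) ℂ) :
    Continuous (objective O : TOp d (2 * t + 2) → ℝ) := by
  have : FirstCountableTopology (TOp d (2 * t + 2)) :=
    inferInstanceAs (FirstCountableTopology (Idx d (2 * t + 2) → Idx d (2 * t + 2) → ℂ))
  have : LocallyCompactSpace (TOp d (2 * t + 2)) :=
    inferInstanceAs (LocallyCompactSpace (Idx d (2 * t + 2) → Idx d (2 * t + 2) → ℂ))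
  have h := continuous_parametric_integral_of_continuous (μ := haarU d)
    (f := fun (C : TOp d (2 * t + 2)) (U : UGroup d) =>
      frobNorm (deviation O C (U : Matrix (Fin d) (Fin d) ℂ)))
    (continuous_frobNorm.comp (continuous_deviation O)) isCompact_univ
  rw [Measure.restrict_univ] at h
  exact h

lemma objective_half_add_le (O : Matrix (Fin d) (Fin d) ℂ) (C D : TOp d (2 * t + 2)) :
    objective O ((1 / 2 : ℂ) • (C + D)) ≤ (objective O C + objective O D) / 2 := by
  have hdev : ∀ U : Matrix (Fin d) (Fin d) ℂ, deviation O ((1 / 2 : ℂ) • (C + D)) U =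
      (1 / 2 : ℂ) • (deviation O C U + deviation O D U) := by
    intro U
    have h1 : combOutput O ((1 / 2 : ℂ) • (C + D)) U =
        (1 / 2 : ℂ) • (combOutput O C U + combOutput O D U) := by
      ext p q
      simp only [combOutput, Matrix.of_apply, Matrix.smul_apply, Matrix.add_apply, smul_eq_mul,
        ← Finset.sum_add_distrib, Finset.mul_sum]
      refine Finset.sum_congr rfl fun i _ => Finset.sum_congr rfl fun j _ => ?_
      split_ifs
      · ring
      · simp
    rw [deviation_eq, deviation_eq, deviation_eq, h1]
    ext p q
    simp only [Matrix.smul_apply, Matrix.sub_apply, Matrix.add_apply, smul_eq_mul]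
    ring
  have hC := integrable_frobNorm_deviation O C
  have hD := integrable_frobNorm_deviation O D
  calc objective O ((1 / 2 : ℂ) • (C + D))
      ≤ ∫ U : UGroup d, (frobNorm (deviation O C (U : Matrix (Fin d) (Fin d) ℂ)) +
          frobNorm (deviation O D (U : Matrix (Fin d) (Fin d) ℂ))) / 2 ∂(haarU d) := by
        refine integral_mono (integrable_frobNorm_deviation O _) ((hC.add hD).div_const 2) ?_
        intro U
        simp only [hdev]
        exact frobNorm_half_add_le _ _
    _ = (objective O C + objective O D) / 2 := by
        rw [integral_div, integral_add hC hD]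
        rfl

variable {O : Matrix (Fin d) (Fin d) ℂ}

/-- The target function is invariant under the symmetry group, because the Haar measure is invariant
under `U ↦ U₀ᵀ U V`. -/
lemma objective_conj (g : SymGroup O) (C : TOp d (2 * t + 2)) :
    objective O (causalRep t g * C * (causalRep t g)ᴴ) = objective O C := by
  have hT1 : (g.1 : Matrix (Fin d) (Fin d) ℂ)ᵀᴴ * (g.1 : Matrix (Fin d) (Fin d) ℂ)ᵀ = 1 := by
    have h := congrArg Matrix.transpose (unitary_mul_conjTranspose g.1)
    rw [Matrix.transpose_mul, Matrix.transpose_one] at h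
    exact h
  have hT2 := mul_eq_one_comm.1 hT1
  let T : UGroup d := ⟨(g.1 : Matrix (Fin d) (Fin d) ℂ)ᵀ, Matrix.mem_unitaryGroup_iff'.2 hT1⟩
  have hTdef : (T : Matrix (Fin d) (Fin d) ℂ) = (g.1 : Matrix (Fin d) (Fin d) ℂ)ᵀ := rfl
  have hV : (g.2.1 : Matrix (Fin d) (Fin d) ℂ) * O * (g.2.1 : Matrix (Fin d) (Fin d) ℂ)ᴴ = O := by
    have h : (g.2.1 : Matrix (Fin d) (Fin d) ℂ) * O = O * (g.2.1 : Matrix (Fin d) (Fin d) ℂ) :=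
      g.2.1.2
    rw [h, Matrix.mul_assoc, unitary_mul_conjTranspose, Matrix.mul_one]
  have key : ∀ U : UGroup d, frobNorm (deviation O (causalRep t g * C * (causalRep t g)ᴴ)
      (U : Matrix (Fin d) (Fin d) ℂ)) = frobNorm (deviation O C
        ((T * U * (g.2.1 : UGroup d) : UGroup d) : Matrix (Fin d) (Fin d) ℂ)) := by
    intro U
    have hU' : ((T * U * (g.2.1 : UGroup d) : UGroup d) : Matrix (Fin d) (Fin d) ℂ) =
        (g.1 : Matrix (Fin d) (Fin d) ℂ)ᵀ * (U : Matrix (Fin d) (Fin d) ℂ) *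
          (g.2.1 : Matrix (Fin d) (Fin d) ℂ) := rfl
    rw [hU', deviation_eq, deviation_eq, combOutput_conj]
    have hUO : (U : Matrix (Fin d) (Fin d) ℂ) * O * (U : Matrix (Fin d) (Fin d) ℂ)ᴴ =
        (g.1 : Matrix (Fin d) (Fin d) ℂ)ᵀᴴ * ((g.1 : Matrix (Fin d) (Fin d) ℂ)ᵀ *
          (U : Matrix (Fin d) (Fin d) ℂ) * (g.2.1 : Matrix (Fin d) (Fin d) ℂ) * O *
          ((g.1 : Matrix (Fin d) (Fin d) ℂ)ᵀ * (U : Matrix (Fin d) (Fin d) ℂ) *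
          (g.2.1 : Matrix (Fin d) (Fin d) ℂ))ᴴ) * (g.1 : Matrix (Fin d) (Fin d) ℂ)ᵀ := by
      rw [← hTdef] at hT1 ⊢
      symm
      calc _ = ((T : Matrix (Fin d) (Fin d) ℂ)ᴴ * (T : Matrix (Fin d) (Fin d) ℂ)) *
            (U : Matrix (Fin d) (Fin d) ℂ) * ((g.2.1 : Matrix (Fin d) (Fin d) ℂ) * O *
              (g.2.1 : Matrix (Fin d) (Fin d) ℂ)ᴴ) * (U : Matrix (Fin d) (Fin d) ℂ)ᴴ *
            ((T : Matrix (Fin d) (Fin d) ℂ)ᴴ * (T : Matrix (Fin d) (Fin d) ℂ)) := by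
            simp only [Matrix.conjTranspose_mul, Matrix.mul_assoc]
        _ = _ := by rw [hT1, hV, Matrix.one_mul, Matrix.mul_one]
    rw [hUO, ← Matrix.sub_mul, ← Matrix.mul_sub, frobNorm_eq_sqrt, frobNorm_eq_sqrt,
      sqNorm_mul_mul _ _ _ (by rw [Matrix.conjTranspose_conjTranspose]; exact hT2) hT2]
  unfold objective
  simp only [key]
  rw [integral_mul_left_eq_self (fun U : UGroup d => frobNorm (deviation O C
      ((U * (g.2.1 : UGroup d) : UGroup d) : Matrix (Fin d) (Fin d) ℂ))) T,
    integral_mul_right_eq_self (fun U : UGroup d =>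
      frobNorm (deviation O C (U : Matrix (Fin d) (Fin d) ℂ))) (g.2.1 : UGroup d)]

/-! ### The feasible set -/

lemma IsFeasible.conj (g : SymGroup O) {C : TOp d (2 * t + 2)} (hC : IsFeasible C) :
    IsFeasible (causalRep t g * C * (causalRep t g)ᴴ) := by
  refine ⟨hC.posSemidef.mul_mul_conjTranspose_same _, fun s hs => ?_, ?_⟩
  · rw [causalRep_eq_tensorOp,
      tailTrace_conj (by omega : 2 * s + 1 ≤ 2 * t + 2) _ (causalFactor_conjTranspose_mul g),
      tailTrace_conj (by omega : 2 * s ≤ 2 * t + 2) _ (causalFactor_conjTranspose_mul g),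
      hC.comb s hs]
    exact (tensorLast_conj (fun l : Fin (2 * s + 1) => causalFactor t g (Fin.castLE (by omega) l))
      (fun l => causalFactor_mul_conjTranspose g _) _ _).symm
  · rw [Matrix.trace_mul_comm, ← Matrix.mul_assoc, causalRep_conjTranspose_mul, Matrix.one_mul,
      hC.trace_eq]

lemma tailTrace_smul_add {n : ℕ} (m : ℕ) (c : ℂ) (C D : TOp d n) :
    tailTrace m (c • (C + D)) = c • (tailTrace m C + tailTrace m D) := by
  ext i j
  simp only [tailTrace_apply, Matrix.smul_apply, Matrix.add_apply, smul_eq_mul, Finset.mul_sum,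
    ← Finset.sum_add_distrib]

lemma tensorLast_smul_add {m : ℕ} (c : ℂ) (C D : TOp d m) (B : Matrix (Fin d) (Fin d) ℂ) :
    tensorLast (c • (C + D)) B = c • (tensorLast C B + tensorLast D B) := by
  ext i j
  simp only [tensorLast, Matrix.of_apply, Matrix.smul_apply, Matrix.add_apply, smul_eq_mul]
  ring

lemma IsFeasible.half_add {C D : TOp d (2 * t + 2)} (hC : IsFeasible C) (hD : IsFeasible D) :
    IsFeasible ((1 / 2 : ℂ) • (C + D)) := by
  refine ⟨(hC.posSemidef.add hD.posSemidef).smul (by positivity), fun s hs => ?_, ?_⟩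
  · rw [tailTrace_smul_add, tailTrace_smul_add, tensorLast_smul_add, hC.comb s hs, hD.comb s hs]
  · rw [Matrix.trace_smul, Matrix.trace_add, hC.trace_eq, hD.trace_eq, smul_eq_mul]
    ring

/-- The maximally mixed comb is feasible. -/
lemma isFeasible_smul_one (hd : 0 < d) :
    IsFeasible ((((d : ℂ) ^ (t + 1))⁻¹) • (1 : TOp d (2 * t + 2))) := by
  have hd' : (d : ℂ) ≠ 0 := Nat.cast_ne_zero.2 hd.ne'
  have htail : ∀ m (c : ℂ), m ≤ 2 * t + 2 → tailTrace m (c • (1 : TOp d (2 * t + 2))) =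
      (c * (d : ℂ) ^ (2 * t + 2 - m)) • (1 : TOp d m) := by
    intro m c hm
    ext i j
    have hinj : ∀ z : Idx d (2 * t + 2 - m), (glue i z : Idx d (2 * t + 2)) = glue j z ↔ i = j := by
      intro z
      refine ⟨fun h => ?_, fun h => by rw [h]⟩
      exact congrArg Prod.fst ((splitEquiv hm).symm.injective (a₁ := (i, z)) (a₂ := (j, z)) h)
    simp only [tailTrace_apply, Matrix.smul_apply, Matrix.one_apply, hinj, Finset.sum_const,
      Finset.card_univ, Fintype.card_pi, Fintype.card_fin, Finset.prod_const, smul_eq_mul,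
      nsmul_eq_mul, Nat.cast_pow]
    ring
  refine ⟨Matrix.PosSemidef.one.smul (by positivity), fun s hs => ?_, ?_⟩
  · rw [htail _ _ (by omega), htail _ _ (by omega)]
    have hone : ∀ c : ℂ, tensorLast (c • (1 : TOp d (2 * s)))
        ((1 / (d : ℂ)) • (1 : Matrix (Fin d) (Fin d) ℂ)) =
          (c * (1 / (d : ℂ))) • (1 : TOp d (2 * s + 1)) := by
      intro c
      rw [tensorLast_eq_kronecker, Matrix.smul_kronecker, Matrix.kronecker_smul,
        Matrix.one_kronecker_one, smul_smul, Matrix.submatrix_smul]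
      simp [Pi.smul_apply]
    rw [hone]
    congr 1
    have : 2 * t + 2 - 2 * s = (2 * t + 2 - (2 * s + 1)) + 1 := by omega
    rw [this, pow_succ]
    field_simp
    ring
  · rw [Matrix.trace_smul, Matrix.trace_one]
    simp only [Fintype.card_pi, Fintype.card_fin, Finset.prod_const, Finset.card_univ,
      Nat.cast_pow, smul_eq_mul]
    have : 2 * t + 2 = (t + 1) + (t + 1) := by ring
    rw [this, pow_add _ (t + 1) (t + 1), inv_mul_cancel_left₀ (pow_ne_zero _ hd')]

lemma norm_apply_le_trace {n : Type*} [Fintype n] [DecidableEq n] {A : Matrix n n ℂ}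
    (hA : A.PosSemidef) (i j : n) : ‖A i j‖ ≤ A.trace.re := by
  obtain ⟨B, rfl⟩ := exists_eq_conjTranspose_mul_self hA
  rw [← sqNorm_eq_trace, Complex.ofReal_re, Matrix.mul_apply]
  refine (norm_sum_le _ _).trans (Finset.sum_le_sum fun k _ => ?_)
  rw [Matrix.conjTranspose_apply, norm_mul, norm_star]
  have hle : ∀ l, ‖B k l‖ ^ 2 ≤ ∑ l, ‖B k l‖ ^ 2 := fun l =>
    Finset.single_le_sum (f := fun l => ‖B k l‖ ^ 2) (fun _ _ => sq_nonneg _) (Finset.mem_univ l)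
  nlinarith [hle i, hle j, sq_nonneg (‖B k i‖ - ‖B k j‖)]

lemma isCompact_isFeasible : IsCompact {C : TOp d (2 * t + 2) | IsFeasible C} := by
  have hc : IsCompact (Set.pi Set.univ (fun _ : Idx d (2 * t + 2) => Set.pi Set.univ
      (fun _ : Idx d (2 * t + 2) => Metric.closedBall (0 : ℂ) (((d : ℂ) ^ (t + 1)).re)))) :=
    isCompact_univ_pi fun _ => isCompact_univ_pi fun _ => isCompact_closedBall _ _
  refine hc.of_isClosed_subset ?_ ?_
  · have h : {C : TOp d (2 * t + 2) | IsFeasible C} =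
        ({C | Cᴴ = C} ∩ ⋂ x : Idx d (2 * t + 2) → ℂ, {C | 0 ≤ star x ⬝ᵥ (C *ᵥ x)}) ∩
        (⋂ s : {s : ℕ // s ≤ t}, {C | tailTrace (2 * s.1 + 1) C = tensorLast (tailTrace (2 * s.1) C)
          ((1 / (d : ℂ)) • (1 : Matrix (Fin d) (Fin d) ℂ))}) ∩
        {C | C.trace = (d : ℂ) ^ (t + 1)} := by
      ext C
      simp only [Set.mem_inter_iff, Set.mem_iInter, Set.mem_ofPred_eq, Subtype.forall]
      constructor
      · intro hC
        exact ⟨⟨Matrix.posSemidef_iff_dotProduct_mulVec.1 hC.posSemidef, hC.comb⟩, hC.trace_eq⟩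
      · rintro ⟨⟨h1, h2⟩, h3⟩
        exact ⟨Matrix.posSemidef_iff_dotProduct_mulVec.2 h1, h2, h3⟩
    rw [h]
    have hent : ∀ i j, Continuous fun C : TOp d (2 * t + 2) => C i j := fun i j =>
      continuous_id.matrix_elem i j
    have htail : ∀ m, Continuous fun C : TOp d (2 * t + 2) => tailTrace m C := fun m =>
      continuous_matrix fun i j => continuous_finsetSum _ fun z _ => hent _ _
    refine IsClosed.inter (IsClosed.inter (IsClosed.inter ?_ ?_) ?_) ?_
    · exact isClosed_eq continuous_id.matrix_conjTranspose continuous_id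
    · refine isClosed_iInter fun x => isClosed_le continuous_const ?_
      exact continuous_const.dotProduct (continuous_id.matrix_mulVec continuous_const)
    · refine isClosed_iInter fun s => isClosed_eq (htail _) ?_
      exact continuous_matrix fun i j => ((htail _).matrix_elem _ _).mul continuous_const
    · exact isClosed_eq continuous_id.matrix_trace continuous_const
  · intro C hC i _ j _
    rw [mem_closedBall_zero_iff, ← hC.trace_eq]
    exact norm_apply_le_trace hC.posSemidef i j

variable (t) in
/-- The minimum of the original program is attained at a symmetric operator: the set of all
minimizers is compact, convex and invariant under the symmetry group, so its unique element of least
Frobenius norm is fixed by the group. -/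
theorem exists_symmetric_minimizer (hd : 0 < d) (O : Matrix (Fin d) (Fin d) ℂ) :
    ∃ C : TOp d (2 * t + 2), IsFeasible C ∧ IsSymmetric O C ∧
      ∀ D : TOp d (2 * t + 2), IsFeasible D → objective O C ≤ objective O D := by
  obtain ⟨C₁, hC₁, hmin⟩ := isCompact_isFeasible.exists_isMinOn
    ⟨_, isFeasible_smul_one (t := t) hd⟩ (continuous_objective O).continuousOn
  have hcompact : IsCompact ({C : TOp d (2 * t + 2) | IsFeasible C} ∩
      {C | objective O C ≤ objective O C₁}) :=
    isCompact_isFeasible.inter_right (isClosed_le (continuous_objective O) continuous_const)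
  obtain ⟨C, ⟨hCf, hCm⟩, hCn⟩ := hcompact.exists_isMinOn ⟨C₁, hC₁, le_refl (objective O C₁)⟩
    continuous_sqNorm.continuousOn
  refine ⟨C, hCf, ?_, fun D hD => le_trans hCm (hmin hD)⟩
  rw [isSymmetric_iff]
  intro g
  rw [commute_iff_conj_eq]
  set D := causalRep t g * C * (causalRep t g)ᴴ with hD
  have hDf : IsFeasible D := hCf.conj g
  have hDm : objective O D = objective O C := objective_conj g C
  have hDn : sqNorm D = sqNorm C := sqNorm_mul_mul _ _ _ (causalRep_conjTranspose_mul g) (by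
    rw [Matrix.conjTranspose_conjTranspose, causalRep_conjTranspose_mul])
  have hmid : sqNorm C ≤ sqNorm ((1 / 2 : ℂ) • (D + C)) := by
    refine hCn ⟨hDf.half_add hCf, ?_⟩
    have h1 := objective_half_add_le O D C
    have h2 : objective O C ≤ objective O C₁ := hCm
    change objective O ((1 / 2 : ℂ) • (D + C)) ≤ objective O C₁
    linarith
  exact eq_of_sqNorm_le_midpoint (hDn.trans_le hmid) hmid

end Minimum

end ShadowInversion

open ShadowInversion
theorem mainTheorem3 (d t : ℕ) (hd : 0 < d) (ht : 0 < t)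
    (O : Matrix (Fin d) (Fin d) ℂ) (hO : O.IsHermitian) :
    -- the integrals that are minimized are those of integrable functions
    (∀ C : TOp d (2 * t + 2), MeasureTheory.Integrable
      (fun U : UGroup d => frobNorm (deviation O C (U : Matrix (Fin d) (Fin d) ℂ))) (haarU d)) ∧
    -- a Schur basis exists, and for every one of them and every grouping permutation:
    Nonempty (SchurBasis d t O) ∧
    ∀ (S : SchurBasis d t O) (π : Equiv.Perm (Fin (2 * t + 2))), IsGrouping t π →
      -- blocks parametrize the symmetric operators, with the same constraints and target function
      Set.BijOn (S.assemble π) Set.univ {C | IsSymmetric O C} ∧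
      (∀ X : S.Blocks, S.IsReducedFeasible π X ↔ IsFeasible (S.assemble π X)) ∧
      (∀ X : S.Blocks, S.reducedObjective π X = objective O (S.assemble π X)) ∧
      -- both programs attain their minima, and the minima are equal
      ∃ v : ℝ, IsLeast (objective O '' {C : TOp d (2 * t + 2) | IsFeasible C}) v ∧
        IsLeast (S.reducedObjective π '' {X | S.IsReducedFeasible π X}) v := by
  refine ⟨fun C => integrable_frobNorm_deviation O C, nonempty_schurBasis d t O,
    fun S π hπ => ⟨S.bijOn_assemble hπ, fun X => S.isReducedFeasible_iff hd hπ X,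
      fun X => S.reducedObjective_eq π X, ?_⟩⟩
  obtain ⟨C, hCf, hCs, hmin⟩ := exists_symmetric_minimizer t hd O
  obtain ⟨X, -, rfl⟩ := (S.bijOn_assemble hπ).surjOn hCs
  refine ⟨objective O (S.assemble π X), ⟨⟨_, hCf, rfl⟩, ?_⟩,
    ⟨⟨X, (S.isReducedFeasible_iff hd hπ X).2 hCf, S.reducedObjective_eq π X⟩, ?_⟩⟩
  · rintro _ ⟨D, hD, rfl⟩
    exact hmin D hD
  · rintro _ ⟨Y, hY, rfl⟩
    rw [S.reducedObjective_eq]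
    exact hmin _ ((S.isReducedFeasible_iff hd hπ Y).1 hY)
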